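/- Let $\Bbbk$ be an uncountable algebraically closed field of characteristic $0$ and let $X$ be a smooth irreducible quasi-projective variety of dimension $n$ over $\Bbbk$, with structure sheaf $\mathcal O$ and tangent sheaf $\Theta$. An étale chart is an affine open set $U\subset X$ admitting uniformizing parameters, i.e. $x_1,\dots,x_n\in A=\mathcal O(U)$ that are algebraically independent, such that $A$ is algebraic over $\Bbbk[x_1,\dots,x_n]$ and each $\partial/\partial x_i$ extends to a derivation of $A$. On an étale chart put $V=\Theta(U)=\mathrm{Der}(A)$, let $\Delta$ be the kernel of the multiplication $A\otimes A\to A$, let $A\# V\subset A\# U(V)$ be the Lie algebra $A\otimes V$ with $[f\#\eta,g\#\mu]=f\eta(g)\#\mu-g\mu(f)\#\eta+fg\#[\eta,\mu]$, let $\widehat J_U=\varprojlim_l (A\# V)/(\Delta^l\otimes_A V)$, and let $\widehat{\mathcal{AV}}(U)=A\# U(\widehat J_U)/\langle f\# s-1\# fs\mid f\in A,\ s\in\widehat J_U\rangle$. These algebras are the sections over étale charts of a sheaf of algebras $\widehat{\mathcal{AV}}$ on $X$; an $\widehat{\mathcal{AV}}$-module is a quasi-coherent sheaf on $X$ that is a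 module over $\widehat{\mathcal{AV}}$. It is *simple* if it is nonzero, has no $\widehat{\mathcal{AV}}$-submodules other than $0$ and itself, and for every étale chart $U$ its module of sections over $U$ is zero or a simple $\widehat{\mathcal{AV}}(U)$-module. It is *holonomic* if it is zero, or if it is locally finitely generated over $\widehat{\mathcal{AV}}$ and the supremum over $p\in X$ of the Gelfand–Kirillov dimensions of its stalks over $\widehat{\mathcal{AV}}_p$ equals $n$. Let $W$ be a finite-dimensional $\mathfrak{gl}_n$-module. For a module $P$ over the algebra $\mathcal D(U)$ of differential operators on an étale chart $U$, with uniformizing parameters $x_1,\dots,x_n$, let $T(P,W)=P\otimes_\Bbbk W$ be the $\widehat{\mathcal{AV}}(U)$-module on which $\mathcal O(U)$ acts on the left factor, vector fields act by $$\Big(f\frac{\partial}{\partial x_i}\Big)(p\otimes w)=\Big(f\frac{\partial}{\partial x_i}p\Big)\otimes w+\sum_{j=1}^n\frac{\partial f}{\partial x_j}\,p\otimes E_{ji}w,$$ and the kernel of $\widehat J_U\to (A\# V)/(\Delta^2\otimes_A V)$ acts by zero. An $\widehat{\mathcal{AV}}$-module $\mathcal M$ is *of type $W$* if for every étale chart $U$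 there is a $\mathcal D(U)$-module $P_U$ with $\mathcal M(U)\cong T(P_U,W)$ as $\widehat{\mathcal{AV}}(U)$-modules. **Theorem.** Let $W$ be a simple finite-dimensional $\mathfrak{gl}_n$-module that is not isomorphic to the exterior power $\Lambda^k(\Bbbk^n)$ of the natural representation for any $k=0,\dots,n$, and let $\mathcal M$ be a simple holonomic $\widehat{\mathcal{AV}}$-module of type $W$. Then $\mathcal M$ is a locally simple sheaf of $\Theta$-modules: for every étale chart $U\subset X$, $\mathcal M(U)$ is either zero or a simple module over the Lie algebra $\Theta(U)$ of vector fields on $U$. -/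

import Mathlib

open scoped TensorProduct
universe u v
attribute [local instance 100] LieRing.ofAssociativeRing

section Jets
variable (k A : Type u) [CommRing k] [CommRing A] [Algebra k A]

/-- The Lie algebra `A # V`, `V = Der(A)`, inside the smash product `A # U(V)`; as a module it is
`A ⊗ V`, and `f ⊗ η` stands for `f # η`. -/
def SmashLie : Type u := A ⊗[k] Derivation k A A

namespace SmashLie
noncomputable instance : AddCommGroup (SmashLie k A) :=
  inferInstanceAs (AddCommGroup (A ⊗[k] Derivation k A A))
noncomputable instance : Module k (SmashLie k A) :=
  inferInstanceAs (Module k (A ⊗[k] Derivation k A A))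
noncomputable instance : Module A (SmashLie k A) :=
  inferInstanceAs (Module A (A ⊗[k] Derivation k A A))
instance : IsScalarTower k A (SmashLie k A) :=
  inferInstanceAs (IsScalarTower k A (A ⊗[k] Derivation k A A))

variable {k A}

/-- The element `f # η`. -/
noncomputable def mk (f : A) (η : Derivation k A A) : SmashLie k A :=
  (f ⊗ₜ[k] η : A ⊗[k] Derivation k A A)

/-- The bilinear map `(f, η) ↦ f # η`. -/
noncomputable def mkₗ : A →ₗ[k] Derivation k A A →ₗ[k] SmashLie k A :=
  TensorProduct.mk k A (Derivation k A A)

@[simp] theorem mkₗ_apply (f : A) (η : Derivation k A A) : mkₗ f η = mk f η := rfl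

@[simp] theorem smul_mk (a f : A) (η : Derivation k A A) : a • mk f η = mk (a * f) η := rfl

theorem mk_add_left (f g : A) (η : Derivation k A A) : mk (f + g) η = mk f η + mk g η :=
  TensorProduct.add_tmul f g η
theorem mk_sub_left (f g : A) (η : Derivation k A A) : mk (f - g) η = mk f η - mk g η :=
  TensorProduct.sub_tmul f g η
theorem mk_add_right (f : A) (η μ : Derivation k A A) : mk f (η + μ) = mk f η + mk f μ :=
  TensorProduct.tmul_add f η μ
theorem mk_sub_right (f : A) (η μ : Derivation k A A) : mk f (η - μ) = mk f η - mk f μ :=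
  TensorProduct.tmul_sub f η μ

theorem induction {p : SmashLie k A → Prop} (x : SmashLie k A) (zero : p 0)
    (mk : ∀ f η, p (mk f η)) (add : ∀ x y, p x → p y → p (x + y)) : p x :=
  TensorProduct.induction_on x zero mk add

variable (k A) in
/-- The map `A # V → V`, `f # η ↦ f η`, giving the action of `A # V` on `A`. -/
noncomputable def anchor : SmashLie k A →ₗ[k] Derivation k A A :=
  TensorProduct.lift (LinearMap.mk₂ k (fun (f : A) (η : Derivation k A A) => f • η)
    (fun _ _ _ => add_smul _ _ _) (fun _ _ _ => smul_assoc _ _ _)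
    (fun _ _ _ => smul_add _ _ _) (fun _ _ _ => smul_comm _ _ _))

@[simp] theorem anchor_mk (f : A) (η : Derivation k A A) : anchor k A (mk f η) = f • η := rfl

/-- The map `g # μ ↦ d(g) # μ`. -/
noncomputable def actLeft : Derivation k A A →ₗ[k] SmashLie k A →ₗ[k] SmashLie k A where
  toFun d := LinearMap.rTensor (Derivation k A A) (d : A →ₗ[k] A)
  map_add' d e := LinearMap.rTensor_add (Derivation k A A) (d : A →ₗ[k] A) (e : A →ₗ[k] A)
  map_smul' c d := LinearMap.rTensor_smul (Derivation k A A) c (d : A →ₗ[k] A)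

@[simp] theorem actLeft_mk (d : Derivation k A A) (g : A) (μ : Derivation k A A) :
    actLeft d (mk g μ) = mk (d g) μ := rfl

/-- The `A`-bilinear map `(f # η, g # μ) ↦ f g # [η, μ]`. -/
noncomputable def lieRight : SmashLie k A →ₗ[k] SmashLie k A →ₗ[k] SmashLie k A :=
  TensorProduct.map₂ (LinearMap.mul k A)
    (LinearMap.mk₂ k (fun η μ : Derivation k A A => ⁅η, μ⁆)
      add_lie (fun c η μ => smul_lie c η μ) lie_add (fun c η μ => lie_smul c η μ))

@[simp] theorem lieRight_mk (f g : A) (η μ : Derivation k A A) :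
    lieRight (mk f η) (mk g μ) = mk (f * g) ⁅η, μ⁆ :=
  rfl

/-- The commutator bracket `[f # η, g # μ] = f η(g) # μ - g μ(f) # η + f g # [η, μ]`. -/
noncomputable instance : Bracket (SmashLie k A) (SmashLie k A) where
  bracket x y := actLeft (anchor k A x) y - actLeft (anchor k A y) x + lieRight x y

theorem lie_def (x y : SmashLie k A) :
    ⁅x, y⁆ = actLeft (anchor k A x) y - actLeft (anchor k A y) x + lieRight x y := rfl

theorem lie_mk_mk (f g : A) (η μ : Derivation k A A) :
    ⁅mk f η, mk g μ⁆ = mk (f * η g) μ - mk (g * μ f) η + mk (f * g) ⁅η, μ⁆ := by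
  simp [lie_def]

theorem add_lie' (x y z : SmashLie k A) : ⁅x + y, z⁆ = ⁅x, z⁆ + ⁅y, z⁆ := by
  simp only [lie_def, map_add, LinearMap.add_apply]; abel

theorem lie_add' (x y z : SmashLie k A) : ⁅x, y + z⁆ = ⁅x, y⁆ + ⁅x, z⁆ := by
  simp only [lie_def, map_add, LinearMap.add_apply]; abel

theorem zero_lie' (x : SmashLie k A) : ⁅(0 : SmashLie k A), x⁆ = 0 := by simp [lie_def]
theorem lie_zero' (x : SmashLie k A) : ⁅x, (0 : SmashLie k A)⁆ = 0 := by simp [lie_def]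

theorem lie_skew' (x y : SmashLie k A) : ⁅x, y⁆ = -⁅y, x⁆ := by
  have h : lieRight x y = - lieRight y x := by
    induction x using induction with
    | zero => simp
    | add x₁ x₂ h₁ h₂ => simp [h₁, h₂, add_comm]
    | mk f η =>
      induction y using induction with
      | zero => simp
      | add y₁ y₂ h₁ h₂ => simp [h₁, h₂, add_comm]
      | mk g μ =>
        rw [lieRight_mk, lieRight_mk, ← lie_skew, mul_comm f g]
        exact TensorProduct.tmul_neg _ _
  rw [lie_def, lie_def, h]; abel

theorem leibniz_mk (f g h : A) (η μ ν : Derivation k A A) :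
    ⁅mk f η, ⁅mk g μ, mk h ν⁆⁆ = ⁅⁅mk f η, mk g μ⁆, mk h ν⁆ + ⁅mk g μ, ⁅mk f η, mk h ν⁆⁆ := by
  have e1 : ∀ x y z : SmashLie k A, ⁅x, y - z⁆ = ⁅x, y⁆ - ⁅x, z⁆ := fun x y z => by
    simp only [lie_def, map_sub, LinearMap.sub_apply]; abel
  have e2 : ∀ x y z : SmashLie k A, ⁅x - y, z⁆ = ⁅x, z⁆ - ⁅y, z⁆ := fun x y z => by
    simp only [lie_def, map_sub, LinearMap.sub_apply]; abel
  have j : ⁅η, ⁅μ, ν⁆⁆ = ⁅⁅η, μ⁆, ν⁆ + ⁅μ, ⁅η, ν⁆⁆ := leibniz_lie η μ ν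
  have s : mk (g * f * h) ⁅μ, ⁅η, ν⁆⁆ = mk (f * g * h) ⁅μ, ⁅η, ν⁆⁆ := by rw [mul_comm g f]
  have t : ∀ c : A, mk c ⁅μ, η⁆ = - mk c ⁅η, μ⁆ := fun c => by
    rw [← lie_skew]; exact TensorProduct.tmul_neg _ _
  simp only [lie_mk_mk, add_lie', lie_add', e1, e2, Derivation.leibniz, smul_eq_mul, j,
    Derivation.commutator_apply, mk_add_right, t]
  simp only [mul_add, mul_sub, mk_add_left, mk_sub_left]
  ring_nf
  abel

noncomputable instance : LieRing (SmashLie k A) where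
  add_lie := add_lie'
  lie_add := lie_add'
  lie_self x := by
    have h : lieRight x x = 0 := by
      induction x using induction with
      | zero => simp
      | mk f η => rw [lieRight_mk, lie_self]; exact TensorProduct.tmul_zero _ _
      | add x y hx hy =>
        have := lie_skew' x y
        rw [lie_def, lie_def] at this
        have h2 : lieRight x y + lieRight y x = 0 := by
          have h3 := eq_neg_iff_add_eq_zero.1 this
          rw [← h3]; abel
        simp only [map_add, LinearMap.add_apply, hx, hy, zero_add, add_zero]
        rw [← h2]; abel
    rw [lie_def, h]; abel
  leibniz_lie x y z := by
    induction x using induction with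
    | zero => simp only [zero_lie', lie_zero', add_zero]
    | add x₁ x₂ h₁ h₂ => simp only [add_lie', lie_add', h₁, h₂]; abel
    | mk f η =>
      induction y using induction with
      | zero => simp only [zero_lie', lie_zero', add_zero]
      | add y₁ y₂ h₁ h₂ => simp only [add_lie', lie_add', h₁, h₂]; abel
      | mk g μ =>
        induction z using induction with
        | zero => simp only [lie_zero', add_zero]
        | add z₁ z₂ h₁ h₂ => simp only [lie_add', h₁, h₂]; abel
        | mk h ν => exact leibniz_mk f g h η μ ν

noncomputable instance : LieAlgebra k (SmashLie k A) where
  lie_smul c x y := by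
    simp only [lie_def, map_smul, LinearMap.smul_apply, smul_add, smul_sub]


/-- For a fixed `η`, the map `A ⊗ A → A # V`, `f ⊗ g ↦ f # g η`. -/
noncomputable def ofTensor (η : Derivation k A A) : A ⊗[k] A →ₗ[k] SmashLie k A :=
  LinearMap.lTensor A ((LinearMap.toSpanSingleton A (Derivation k A A) η).restrictScalars k)

@[simp] theorem ofTensor_tmul (η : Derivation k A A) (f g : A) :
    ofTensor η (f ⊗ₜ g) = mk f (g • η) := rfl

variable (k A) in
/-- The subspace `Δ ^ l ⊗_A V` of `A # V = (A ⊗ A) ⊗_A V`, where `Δ` is the kernel of the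
multiplication map `A ⊗ A → A`. -/
noncomputable def deltaSub (l : ℕ) : Submodule k (SmashLie k A) :=
  Submodule.span k {x | ∃ z ∈ KaehlerDifferential.ideal k A ^ l, ∃ η, ofTensor η z = x}

theorem ofTensor_mem {l : ℕ} (η : Derivation k A A) {z : A ⊗[k] A}
    (hz : z ∈ KaehlerDifferential.ideal k A ^ l) : ofTensor η z ∈ deltaSub k A l :=
  Submodule.subset_span ⟨z, hz, η, rfl⟩

theorem deltaSub_anti {l m : ℕ} (h : m ≤ l) : deltaSub k A l ≤ deltaSub k A m := by
  refine Submodule.span_mono ?_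
  rintro _ ⟨z, hz, η, rfl⟩
  exact ⟨z, Ideal.pow_le_pow_right h hz, η, rfl⟩

theorem smul_ofTensor (a : A) (η : Derivation k A A) (z : A ⊗[k] A) :
    a • ofTensor η z = ofTensor η ((a ⊗ₜ[k] (1 : A)) * z) := by
  induction z using TensorProduct.induction_on with
  | zero => simp
  | tmul f g => simp
  | add x y hx hy => rw [map_add, smul_add, mul_add, map_add, hx, hy]

theorem smul_mem_deltaSub {l : ℕ} (a : A) {x : SmashLie k A} (hx : x ∈ deltaSub k A l) :
    a • x ∈ deltaSub k A l := by
  induction hx using Submodule.span_induction with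
  | zero => rw [smul_zero]; exact zero_mem _
  | add x y _ _ hx hy => rw [smul_add]; exact add_mem hx hy
  | smul c x _ hx => rw [smul_comm]; exact Submodule.smul_mem _ c hx
  | mem x hx =>
    obtain ⟨z, hz, η, rfl⟩ := hx
    rw [smul_ofTensor]
    exact ofTensor_mem η (Ideal.mul_mem_left _ _ hz)

/-- The diagonal action `d ⊗ 1 + 1 ⊗ d` of a derivation on `A ⊗ A`. -/
noncomputable def diag (d : Derivation k A A) : A ⊗[k] A →ₗ[k] A ⊗[k] A :=
  LinearMap.rTensor A (d : A →ₗ[k] A) + LinearMap.lTensor A (d : A →ₗ[k] A)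

theorem diag_tmul (d : Derivation k A A) (f g : A) :
    diag d (f ⊗ₜ g) = d f ⊗ₜ g + f ⊗ₜ d g := rfl

theorem diag_mul (d : Derivation k A A) (x y : A ⊗[k] A) :
    diag d (x * y) = x * diag d y + diag d x * y := by
  induction x using TensorProduct.induction_on with
  | zero => simp
  | add x x' hx hx' => simp only [add_mul, map_add, hx, hx']; ring
  | tmul f g =>
    induction y using TensorProduct.induction_on with
    | zero => simp
    | add y y' hy hy' => simp only [mul_add, map_add, hy, hy']; ring
    | tmul f' g' =>
      simp only [Algebra.TensorProduct.tmul_mul_tmul, diag_tmul, Derivation.leibniz, smul_eq_mul,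
        mul_add, add_mul, TensorProduct.add_tmul, TensorProduct.tmul_add]
      rw [mul_comm f' (d f), mul_comm g' (d g)]
      abel

theorem mul'_diag (d : Derivation k A A) (x : A ⊗[k] A) :
    LinearMap.mul' k A (diag d x) = d (LinearMap.mul' k A x) := by
  induction x using TensorProduct.induction_on with
  | zero => simp
  | add x x' hx hx' => simp only [map_add, hx, hx']
  | tmul f g =>
    simp only [diag_tmul, map_add, LinearMap.mul'_apply, Derivation.leibniz, smul_eq_mul]
    ring

theorem mem_ideal_iff (x : A ⊗[k] A) :
    x ∈ KaehlerDifferential.ideal k A ↔ LinearMap.mul' k A x = 0 := Iff.rfl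

theorem diag_mem (d : Derivation k A A) (l : ℕ) {x : A ⊗[k] A}
    (hx : x ∈ KaehlerDifferential.ideal k A ^ l) :
    diag d x ∈ KaehlerDifferential.ideal k A ^ l := by
  induction l generalizing x with
  | zero => simp
  | succ l ih =>
    rw [pow_succ] at hx ⊢
    induction hx using Submodule.mul_induction_on' with
    | add x _ y _ hx hy => rw [map_add]; exact add_mem hx hy
    | mem_mul_mem x hx y hy =>
      rw [diag_mul]
      refine add_mem (Ideal.mul_mem_mul hx ?_) (Ideal.mul_mem_mul (ih hx) hy)
      rw [mem_ideal_iff] at hy ⊢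
      rw [mul'_diag, hy, map_zero]

theorem anchor_ofTensor (η : Derivation k A A) (z : A ⊗[k] A) :
    anchor k A (ofTensor η z) = LinearMap.mul' k A z • η := by
  induction z using TensorProduct.induction_on with
  | zero => simp
  | add x y hx hy => simp only [map_add, hx, hy, add_smul]
  | tmul f g => simp [mul_smul]

theorem anchor_deltaSub {l : ℕ} {x : SmashLie k A} (hx : x ∈ deltaSub k A (l + 1)) :
    anchor k A x = 0 := by
  induction hx using Submodule.span_induction with
  | zero => simp
  | add x y _ _ hx hy => simp [hx, hy]
  | smul c x _ hx => simp [hx]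
  | mem x hx =>
    obtain ⟨z, hz, η, rfl⟩ := hx
    have hz : z ∈ KaehlerDifferential.ideal k A :=
      Ideal.pow_le_self (Nat.succ_ne_zero l) hz
    rw [anchor_ofTensor, (mem_ideal_iff z).1 hz, zero_smul]

theorem lie_mk_ofTensor (f : A) (μ η : Derivation k A A) (z : A ⊗[k] A) :
    ⁅mk f μ, ofTensor η z⁆ =
      f • (ofTensor η (diag μ z) + ofTensor ⁅μ, η⁆ z) -
        mk ((LinearMap.mul' k A z • η) f) μ := by
  induction z using TensorProduct.induction_on with
  | zero =>
    have : mk (0 : A) μ = 0 := TensorProduct.zero_tmul _ _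
    simp [this]
  | add x y hx hy =>
    simp only [map_add, lie_add, hx, hy, smul_add, add_smul, Derivation.add_apply, mk_add_left]
    abel
  | tmul g h =>
    have e : (⁅μ, h • η⁆ : Derivation k A A) = μ h • η + h • ⁅μ, η⁆ := by
      ext a
      simp only [Derivation.commutator_apply, Derivation.add_apply, Derivation.smul_apply,
        Derivation.leibniz, smul_eq_mul]
      ring
    simp only [ofTensor_tmul, lie_mk_mk, diag_tmul, map_add, smul_add, smul_mk, e, mk_add_right,
      LinearMap.mul'_apply, Derivation.smul_apply, smul_eq_mul, mul_assoc]
    abel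

theorem lie_mem_deltaSub {l : ℕ} (x : SmashLie k A) {y : SmashLie k A}
    (hy : y ∈ deltaSub k A (l + 1)) : ⁅x, y⁆ ∈ deltaSub k A (l + 1) := by
  induction x using induction with
  | zero => rw [zero_lie]; exact zero_mem _
  | add x x' hx hx' => rw [add_lie]; exact add_mem hx hx'
  | mk f μ =>
    induction hy using Submodule.span_induction with
    | zero => rw [lie_zero]; exact zero_mem _
    | add x y _ _ hx hy => rw [lie_add]; exact add_mem hx hy
    | smul c x _ hx => rw [lie_smul]; exact Submodule.smul_mem _ c hx
    | mem x hx =>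
      obtain ⟨z, hz, η, rfl⟩ := hx
      have hz' : z ∈ KaehlerDifferential.ideal k A := Ideal.pow_le_self (Nat.succ_ne_zero l) hz
      rw [lie_mk_ofTensor, (mem_ideal_iff z).1 hz', zero_smul, Derivation.zero_apply]
      have : mk (0 : A) μ = 0 := TensorProduct.zero_tmul _ _
      rw [this, sub_zero]
      exact smul_mem_deltaSub f (add_mem (ofTensor_mem _ (diag_mem μ _ hz)) (ofTensor_mem _ hz))

variable (k A) in
/-- The ideal `Δ ^ (l + 1) ⊗_A V` of the Lie algebra `A # V`. -/
noncomputable def deltaIdeal (l : ℕ) : LieIdeal k (SmashLie k A) where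
  __ := deltaSub k A (l + 1)
  lie_mem := lie_mem_deltaSub _

theorem mem_deltaIdeal {l : ℕ} {x : SmashLie k A} :
    x ∈ deltaIdeal k A l ↔ x ∈ deltaSub k A (l + 1) := Iff.rfl

variable (k A) in
/-- The quotient Lie algebra `(A # V) / (Δ ^ (l + 1) ⊗_A V)`. -/
abbrev Trunc (l : ℕ) : Type u := SmashLie k A ⧸ deltaIdeal k A l

/-- The quotient map `A # V → (A # V) / (Δ ^ (l + 1) ⊗_A V)`. -/
noncomputable def toTrunc (l : ℕ) : SmashLie k A →ₗ[k] Trunc k A l :=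
  (deltaIdeal k A l).toSubmodule.mkQ

theorem toTrunc_lie (l : ℕ) (x y : SmashLie k A) :
    toTrunc l ⁅x, y⁆ = ⁅toTrunc l x, toTrunc l y⁆ := rfl

theorem toTrunc_surjective (l : ℕ) : Function.Surjective (toTrunc (k := k) (A := A) l) :=
  Submodule.mkQ_surjective _

theorem toTrunc_eq_iff {l : ℕ} {x y : SmashLie k A} :
    toTrunc l x = toTrunc l y ↔ x - y ∈ deltaSub k A (l + 1) :=
  Submodule.Quotient.eq _

/-- Multiplication by `a ∈ A` on `(A # V) / (Δ ^ (l + 1) ⊗_A V)`. -/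
noncomputable def truncSMul (l : ℕ) (a : A) : Trunc k A l →ₗ[k] Trunc k A l :=
  Submodule.mapQ _ _ (LinearMap.lsmul A (SmashLie k A) a |>.restrictScalars k)
    (fun _ hx => smul_mem_deltaSub a hx)

theorem truncSMul_toTrunc (l : ℕ) (a : A) (x : SmashLie k A) :
    truncSMul l a (toTrunc l x) = toTrunc l (a • x) := rfl

/-- The action of `(A # V) / (Δ ^ (l + 1) ⊗_A V)` on `A`. -/
noncomputable def truncAnchor (l : ℕ) : Trunc k A l →ₗ[k] Derivation k A A :=
  Submodule.liftQ _ (anchor k A) (fun _ hx => anchor_deltaSub hx)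

end SmashLie

open SmashLie

/-- The inverse limit of the spaces `(A # V) / (Δ ^ (l + 1) ⊗_A V)`, as the space of sequences whose
terms have common representatives in `A # V`. -/
noncomputable def jetSubmodule : Submodule k (∀ l, Trunc k A l) where
  carrier := {s | ∀ l m, m ≤ l → ∃ x : SmashLie k A, toTrunc l x = s l ∧ toTrunc m x = s m}
  zero_mem' l m _ := ⟨0, map_zero _, map_zero _⟩
  add_mem' {s t} hs ht l m h := by
    obtain ⟨x, hx, hx'⟩ := hs l m h
    obtain ⟨y, hy, hy'⟩ := ht l m h
    exact ⟨x + y, by rw [map_add, hx, hy]; rfl, by rw [map_add, hx', hy']; rfl⟩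
  smul_mem' c s hs l m h := by
    obtain ⟨x, hx, hx'⟩ := hs l m h
    exact ⟨c • x, by rw [map_smul, hx]; rfl, by rw [map_smul, hx']; rfl⟩

/-- The Lie algebra of jets of vector fields, the inverse limit of the Lie algebras
`(A # V) / (Δ ^ (l + 1) ⊗_A V)`. -/
def JetLie : Type u := jetSubmodule k A

namespace JetLie
noncomputable instance : AddCommGroup (JetLie k A) := inferInstanceAs (AddCommGroup (jetSubmodule k A))
noncomputable instance : Module k (JetLie k A) := inferInstanceAs (Module k (jetSubmodule k A))

variable {k A}

/-- The component of a jet in `(A # V) / (Δ ^ (l + 1) ⊗_A V)`. -/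
noncomputable def trunc (l : ℕ) : JetLie k A →ₗ[k] Trunc k A l :=
  (LinearMap.proj l).comp (jetSubmodule k A).subtype

theorem ext {s t : JetLie k A} (h : ∀ l, trunc l s = trunc l t) : s = t :=
  Subtype.ext (funext h)

theorem exists_rep (s : JetLie k A) {l m : ℕ} (h : m ≤ l) :
    ∃ x : SmashLie k A, toTrunc l x = trunc l s ∧ toTrunc m x = trunc m s := s.2 l m h

noncomputable instance : Bracket (JetLie k A) (JetLie k A) where
  bracket s t := ⟨fun l => ⁅trunc l s, trunc l t⁆, fun l m h => by
    obtain ⟨x, hx, hx'⟩ := exists_rep s h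
    obtain ⟨y, hy, hy'⟩ := exists_rep t h
    exact ⟨⁅x, y⁆, by rw [toTrunc_lie, hx, hy], by rw [toTrunc_lie, hx', hy']⟩⟩

theorem trunc_lie (l : ℕ) (s t : JetLie k A) : trunc l ⁅s, t⁆ = ⁅trunc l s, trunc l t⁆ := rfl

noncomputable instance : LieRing (JetLie k A) where
  add_lie x y z := ext fun l => by simp only [trunc_lie, map_add, add_lie]
  lie_add x y z := ext fun l => by simp only [trunc_lie, map_add, lie_add]
  lie_self x := ext fun l => by rw [trunc_lie, lie_self, map_zero]
  leibniz_lie x y z := ext fun l => leibniz_lie (trunc l x) (trunc l y) (trunc l z)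

noncomputable instance : LieAlgebra k (JetLie k A) where
  lie_smul c x y := ext fun l => by simp only [trunc_lie, map_smul, lie_smul]

/-- `A` acts on jets by multiplication on the left. -/
noncomputable instance : SMul A (JetLie k A) where
  smul a s := ⟨fun l => truncSMul l a (trunc l s), fun l m h => by
    obtain ⟨x, hx, hx'⟩ := exists_rep s h
    exact ⟨a • x, congrArg (truncSMul l a) hx, congrArg (truncSMul m a) hx'⟩⟩

theorem trunc_smul (l : ℕ) (a : A) (s : JetLie k A) :
    trunc l (a • s) = truncSMul l a (trunc l s) := rfl

variable (k A) in
/-- The action of jets on `A` by derivations. -/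
noncomputable def anchor : JetLie k A →ₗ[k] Derivation k A A := truncAnchor 0 ∘ₗ trunc 0

variable (k A) in
/-- The map from `A # V` to its completion. -/
noncomputable def of : SmashLie k A →ₗ[k] JetLie k A where
  toFun x := ⟨fun l => toTrunc l x, fun _ _ _ => ⟨x, rfl, rfl⟩⟩
  map_add' _ _ := rfl
  map_smul' _ _ := rfl

theorem trunc_of (l : ℕ) (x : SmashLie k A) : trunc l (of k A x) = toTrunc l x := rfl

end JetLie

/-- The defining relations of the algebra generated by `A` and by the jets of vector fields. -/
inductive AVhatRel : FreeAlgebra k (A ⊕ JetLie k A) → FreeAlgebra k (A ⊕ JetLie k A) → Prop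
  | algebraMap (c : k) : AVhatRel (FreeAlgebra.ι k (.inl (algebraMap k A c))) (algebraMap k _ c)
  | add (f g : A) : AVhatRel (FreeAlgebra.ι k (.inl (f + g)))
      (FreeAlgebra.ι k (.inl f) + FreeAlgebra.ι k (.inl g))
  | mul (f g : A) : AVhatRel (FreeAlgebra.ι k (.inl (f * g)))
      (FreeAlgebra.ι k (.inl f) * FreeAlgebra.ι k (.inl g))
  | jet_add (s t : JetLie k A) : AVhatRel (FreeAlgebra.ι k (.inr (s + t)))
      (FreeAlgebra.ι k (.inr s) + FreeAlgebra.ι k (.inr t))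
  | jet_smul (c : k) (s : JetLie k A) : AVhatRel (FreeAlgebra.ι k (.inr (c • s)))
      (c • FreeAlgebra.ι k (.inr s))
  | jet_lie (s t : JetLie k A) : AVhatRel (FreeAlgebra.ι k (.inr ⁅s, t⁆))
      (FreeAlgebra.ι k (.inr s) * FreeAlgebra.ι k (.inr t) -
        FreeAlgebra.ι k (.inr t) * FreeAlgebra.ι k (.inr s))
  | jet_mul (s : JetLie k A) (f : A) :
      AVhatRel (FreeAlgebra.ι k (.inr s) * FreeAlgebra.ι k (.inl f))
      (FreeAlgebra.ι k (.inl f) * FreeAlgebra.ι k (.inr s) +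
        FreeAlgebra.ι k (.inl (JetLie.anchor k A s f)))
  | mul_jet (f : A) (s : JetLie k A) : AVhatRel (FreeAlgebra.ι k (.inr (f • s)))
      (FreeAlgebra.ι k (.inl f) * FreeAlgebra.ι k (.inr s))

/-- The completed algebra `(A # U(J)) / ⟨f # s - 1 # f s⟩`, where `J` is the Lie algebra of jets of
vector fields. -/
def AVhat : Type u := RingQuot (AVhatRel k A)

namespace AVhat
noncomputable instance : Ring (AVhat k A) := inferInstanceAs (Ring (RingQuot (AVhatRel k A)))
noncomputable instance : Algebra k (AVhat k A) :=
  inferInstanceAs (Algebra k (RingQuot (AVhatRel k A)))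

variable {k A}

/-- The generators of `ÂV`. -/
noncomputable def gen (x : A ⊕ JetLie k A) : AVhat k A :=
  RingQuot.mkAlgHom k (AVhatRel k A) (FreeAlgebra.ι k x)

variable (k A) in
/-- The quotient map onto `ÂV`. -/
noncomputable def quot : FreeAlgebra k (A ⊕ JetLie k A) →ₐ[k] AVhat k A :=
  RingQuot.mkAlgHom k (AVhatRel k A)

theorem quot_ι (x : A ⊕ JetLie k A) : quot k A (FreeAlgebra.ι k x) = gen x := rfl

theorem rel {x y : FreeAlgebra k (A ⊕ JetLie k A)} (h : AVhatRel k A x y) :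
    quot k A x = quot k A y := RingQuot.mkAlgHom_rel k h

variable (k A) in
/-- The homomorphism `A → ÂV`. -/
noncomputable def ofFun : A →ₐ[k] AVhat k A where
  toFun f := gen (.inl f)
  map_one' := by simpa [quot_ι] using rel (AVhatRel.algebraMap (k := k) (A := A) 1)
  map_mul' f g := by simpa [quot_ι] using rel (AVhatRel.mul (k := k) f g)
  map_zero' := by simpa [quot_ι] using rel (AVhatRel.algebraMap (k := k) (A := A) 0)
  map_add' f g := by simpa [quot_ι] using rel (AVhatRel.add (k := k) f g)
  commutes' c := by simpa [quot_ι] using rel (AVhatRel.algebraMap (k := k) (A := A) c)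

variable (k A) in
/-- The map from jets of vector fields to `ÂV`. -/
noncomputable def ofJet : JetLie k A →ₗ[k] AVhat k A where
  toFun s := gen (.inr s)
  map_add' s t := by simpa [quot_ι] using rel (AVhatRel.jet_add (k := k) s t)
  map_smul' c s := by simpa [quot_ι] using rel (AVhatRel.jet_smul (k := k) c s)

theorem ofJet_lie (s t : JetLie k A) :
    ofJet k A ⁅s, t⁆ = ofJet k A s * ofJet k A t - ofJet k A t * ofJet k A s := by
  simpa using! rel (AVhatRel.jet_lie (k := k) s t)

theorem ofJet_mul_ofFun (s : JetLie k A) (f : A) :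
    ofJet k A s * ofFun k A f = ofFun k A f * ofJet k A s + ofFun k A (JetLie.anchor k A s f) := by
  simpa using! rel (AVhatRel.jet_mul (k := k) s f)

theorem ofFun_mul_ofJet (f : A) (s : JetLie k A) :
    ofJet k A (f • s) = ofFun k A f * ofJet k A s := by
  simpa using! rel (AVhatRel.mul_jet (k := k) f s)

/-- The universal property of `ÂV`. -/
noncomputable def lift {R : Type*} [Ring R] [Algebra k R] (i : A →ₐ[k] R) (j : JetLie k A →ₗ[k] R)
    (lie : ∀ s t, j ⁅s, t⁆ = j s * j t - j t * j s)
    (leib : ∀ s f, j s * i f = i f * j s + i (JetLie.anchor k A s f))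
    (bal : ∀ f s, j (f • s) = i f * j s) : AVhat k A →ₐ[k] R :=
  RingQuot.liftAlgHom k ⟨FreeAlgebra.lift k (Sum.elim i j), fun x y h => by
    cases h <;> simp [lie, leib, bal]⟩

variable (k A) in
/-- The image of a vector field `η ∈ V`, i.e. of `1 # η`, in `ÂV`; on vector fields this is a
homomorphism of Lie algebras. -/
noncomputable def ofDer : Derivation k A A →ₗ[k] AVhat k A :=
  ofJet k A ∘ₗ JetLie.of k A ∘ₗ SmashLie.mkₗ 1

theorem ofDer_lie (η μ : Derivation k A A) :
    ofDer k A ⁅η, μ⁆ = ofDer k A η * ofDer k A μ - ofDer k A μ * ofDer k A η := by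
  have h : JetLie.of k A (SmashLie.mk 1 ⁅η, μ⁆) =
      ⁅JetLie.of k A (SmashLie.mk 1 η), JetLie.of k A (SmashLie.mk 1 μ)⁆ := by
    have : SmashLie.mk (1 : A) ⁅η, μ⁆ = ⁅SmashLie.mk 1 η, SmashLie.mk 1 μ⁆ := by
      have z : ∀ ν : Derivation k A A, SmashLie.mk (0 : A) ν = 0 :=
        fun ν => TensorProduct.zero_tmul _ _
      simp [SmashLie.lie_mk_mk, z]
    rw [this]; rfl
  simp only [ofDer, LinearMap.comp_apply, SmashLie.mkₗ_apply, h, ofJet_lie]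

end AVhat
end Jets

section Functoriality
variable {k A B : Type u} [CommRing k] [CommRing A] [Algebra k A] [CommRing B] [Algebra k B]


theorem extendDer_unique (φ : A →ₐ[k] B) (h : φ.toRingHom.Etale) {d d' : Derivation k B B}
    (hd : ∀ f, d (φ f) = d' (φ f)) : d = d' := by
  let _ : Algebra A B := φ.toRingHom.toAlgebra
  have _ : Algebra.Etale A B := h
  have hs : ∀ (a : A) (b : B), a • b = φ a * b := fun a b => Algebra.smul_def a b
  let δ : Derivation A B B := Derivation.mk'
    { toFun := fun b => d b - d' b
      map_add' := fun x y => by simp only [map_add]; ring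
      map_smul' := fun a b => by
        simp only [hs, Derivation.leibniz, hd, smul_eq_mul, RingHom.id_apply]; ring }
    (fun x y => by simp only [LinearMap.coe_mk, AddHom.coe_mk, Derivation.leibniz, smul_eq_mul]; ring)
  have hδ : δ = 0 := by
    rw [← δ.liftKaehlerDifferential_comp, Subsingleton.elim δ.liftKaehlerDifferential 0]
    ext; simp
  ext b
  exact sub_eq_zero.1 (DFunLike.congr_fun hδ b)

theorem exists_extendDer (φ : A →ₐ[k] B) (h : φ.toRingHom.Etale) (η : Derivation k A A) :
    ∃ η' : Derivation k B B, ∀ f, η' (φ f) = φ (η f) := by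
  let _ : Algebra A B := φ.toRingHom.toAlgebra
  have _ : Algebra.Etale A B := h
  have _ : IsScalarTower k A B := IsScalarTower.of_algebraMap_eq fun c => (φ.commutes c).symm
  let e := KaehlerDifferential.tensorKaehlerEquivOfFormallyEtale k A B
  let d : Derivation k A B := (Algebra.linearMap A B).compDer η
  let l : Ω[B⁄k] →ₗ[B] B := (d.liftKaehlerDifferential.liftBaseChange B).comp e.symm.toLinearMap
  refine ⟨l.compDer (KaehlerDifferential.D k B), fun f => ?_⟩
  change l (KaehlerDifferential.D k B (algebraMap A B f)) = _
  simp only [l, LinearMap.comp_apply, e, LinearEquiv.coe_coe,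
    KaehlerDifferential.tensorKaehlerEquivOfFormallyEtale_symm_D_algebraMap,
    LinearMap.liftBaseChange_tmul, one_smul, Derivation.liftKaehlerDifferential_comp_D]
  rfl

/-- The unique extension of derivations along an étale homomorphism. -/
noncomputable def extendDer (φ : A →ₐ[k] B) (h : φ.toRingHom.Etale) :
    Derivation k A A →ₗ[k] Derivation k B B where
  toFun η := (exists_extendDer φ h η).choose
  map_add' η μ := extendDer_unique φ h fun f => by
    rw [(exists_extendDer φ h (η + μ)).choose_spec, Derivation.add_apply, Derivation.add_apply,
      map_add, (exists_extendDer φ h η).choose_spec, (exists_extendDer φ h μ).choose_spec]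
  map_smul' c η := extendDer_unique φ h fun f => by
    rw [(exists_extendDer φ h (c • η)).choose_spec, RingHom.id_apply, Derivation.smul_apply,
      Derivation.smul_apply, map_smul, (exists_extendDer φ h η).choose_spec]

theorem extendDer_apply (φ : A →ₐ[k] B) (h : φ.toRingHom.Etale) (η : Derivation k A A) (f : A) :
    extendDer φ h η (φ f) = φ (η f) :=
  (exists_extendDer φ h η).choose_spec f

theorem extendDer_smul (φ : A →ₐ[k] B) (h : φ.toRingHom.Etale) (g : A) (η : Derivation k A A) :
    extendDer φ h (g • η) = φ g • extendDer φ h η :=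
  extendDer_unique φ h fun f => by simp [extendDer_apply]

theorem extendDer_lie (φ : A →ₐ[k] B) (h : φ.toRingHom.Etale) (η μ : Derivation k A A) :
    extendDer φ h ⁅η, μ⁆ = ⁅extendDer φ h η, extendDer φ h μ⁆ :=
  extendDer_unique φ h fun f => by
    simp [Derivation.commutator_apply, extendDer_apply]

namespace SmashLie

/-- The map `f # η ↦ φ(f) # φ(η)` induced by an étale homomorphism `φ`. -/
noncomputable def map (φ : A →ₐ[k] B) (h : φ.toRingHom.Etale) : SmashLie k A →ₗ[k] SmashLie k B :=
  TensorProduct.map φ.toLinearMap (extendDer φ h)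

theorem map_mk (φ : A →ₐ[k] B) (h : φ.toRingHom.Etale) (f : A) (η : Derivation k A A) :
    map φ h (mk f η) = mk (φ f) (extendDer φ h η) := rfl

theorem map_smul' (φ : A →ₐ[k] B) (h : φ.toRingHom.Etale) (a : A) (x : SmashLie k A) :
    map φ h (a • x) = φ a • map φ h x := by
  induction x using induction with
  | zero => simp
  | add x y hx hy => simp only [smul_add, map_add, hx, hy]
  | mk f η => simp [map_mk]

theorem map_lie (φ : A →ₐ[k] B) (h : φ.toRingHom.Etale) (x y : SmashLie k A) :
    map φ h ⁅x, y⁆ = ⁅map φ h x, map φ h y⁆ := by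
  induction x using induction with
  | zero => simp
  | add x x' hx hx' => simp only [add_lie, map_add, hx, hx']
  | mk f η =>
    induction y using induction with
    | zero => simp
    | add y y' hy hy' => simp only [lie_add, map_add, hy, hy']
    | mk g μ => simp [lie_mk_mk, map_mk, extendDer_apply, extendDer_lie]

theorem anchor_map (φ : A →ₐ[k] B) (h : φ.toRingHom.Etale) (x : SmashLie k A) :
    anchor k B (map φ h x) = extendDer φ h (anchor k A x) := by
  induction x using induction with
  | zero => simp
  | add x y hx hy => simp only [map_add, hx, hy]
  | mk f η => simp [map_mk, extendDer_smul]

theorem map_ofTensor (φ : A →ₐ[k] B) (h : φ.toRingHom.Etale) (η : Derivation k A A)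
    (z : A ⊗[k] A) :
    map φ h (ofTensor η z) =
      ofTensor (extendDer φ h η) (Algebra.TensorProduct.map φ φ z) := by
  induction z using TensorProduct.induction_on with
  | zero => simp
  | add x y hx hy => simp only [map_add, hx, hy]
  | tmul f g => simp [map_mk, extendDer_smul]

theorem map_mem_ideal (φ : A →ₐ[k] B) (l : ℕ) {z : A ⊗[k] A}
    (hz : z ∈ KaehlerDifferential.ideal k A ^ l) :
    Algebra.TensorProduct.map φ φ z ∈ KaehlerDifferential.ideal k B ^ l := by
  have h1 : (KaehlerDifferential.ideal k A).map (Algebra.TensorProduct.map φ φ) ≤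
      KaehlerDifferential.ideal k B := by
    rw [Ideal.map_le_iff_le_comap]
    intro x hx
    rw [Ideal.mem_comap, mem_ideal_iff]
    have : LinearMap.mul' k B (Algebra.TensorProduct.map φ φ x) = φ (LinearMap.mul' k A x) := by
      clear hx
      induction x using TensorProduct.induction_on with
      | zero => simp
      | add x y hx hy => simp only [map_add, hx, hy]
      | tmul f g => simp
    rw [this, (mem_ideal_iff x).1 hx, map_zero]
  have h2 := Ideal.mem_map_of_mem (Algebra.TensorProduct.map φ φ) hz
  rw [Ideal.map_pow] at h2
  exact Ideal.pow_right_mono h1 l h2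

theorem map_mem_deltaSub (φ : A →ₐ[k] B) (h : φ.toRingHom.Etale) (l : ℕ) {x : SmashLie k A}
    (hx : x ∈ deltaSub k A l) : map φ h x ∈ deltaSub k B l := by
  induction hx using Submodule.span_induction with
  | zero => rw [map_zero]; exact zero_mem _
  | add x y _ _ hx hy => rw [map_add]; exact add_mem hx hy
  | smul c x _ hx => rw [map_smul]; exact Submodule.smul_mem _ c hx
  | mem x hx =>
    obtain ⟨z, hz, η, rfl⟩ := hx
    rw [map_ofTensor]
    exact ofTensor_mem _ (map_mem_ideal φ l hz)

/-- The map induced on the truncations by an étale homomorphism. -/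
noncomputable def truncMap (φ : A →ₐ[k] B) (h : φ.toRingHom.Etale) (l : ℕ) :
    Trunc k A l →ₗ[k] Trunc k B l :=
  Submodule.mapQ _ _ (map φ h) (fun _ hx => map_mem_deltaSub φ h (l + 1) hx)

theorem truncMap_toTrunc (φ : A →ₐ[k] B) (h : φ.toRingHom.Etale) (l : ℕ) (x : SmashLie k A) :
    truncMap φ h l (toTrunc l x) = toTrunc l (map φ h x) := rfl

end SmashLie

namespace JetLie
open SmashLie

/-- The map induced on jets of vector fields by an étale homomorphism. -/
noncomputable def map (φ : A →ₐ[k] B) (h : φ.toRingHom.Etale) : JetLie k A →ₗ[k] JetLie k B where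
  toFun s := ⟨fun l => truncMap φ h l (trunc l s), fun l m hm => by
    obtain ⟨x, hx, hx'⟩ := exists_rep s hm
    exact ⟨SmashLie.map φ h x, congrArg (truncMap φ h l) hx, congrArg (truncMap φ h m) hx'⟩⟩
  map_add' s t := ext fun l => map_add (truncMap φ h l) (trunc l s) (trunc l t)
  map_smul' c s := ext fun l => map_smul (truncMap φ h l) c (trunc l s)

theorem trunc_map (φ : A →ₐ[k] B) (h : φ.toRingHom.Etale) (l : ℕ) (s : JetLie k A) :
    trunc l (map φ h s) = truncMap φ h l (trunc l s) := rfl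

theorem map_lie (φ : A →ₐ[k] B) (h : φ.toRingHom.Etale) (s t : JetLie k A) :
    map φ h ⁅s, t⁆ = ⁅map φ h s, map φ h t⁆ := ext fun l => by
  obtain ⟨x, hx, -⟩ := exists_rep s (le_refl l)
  obtain ⟨y, hy, -⟩ := exists_rep t (le_refl l)
  simp only [trunc_map, trunc_lie, ← hx, ← hy, ← toTrunc_lie, truncMap_toTrunc, SmashLie.map_lie]

theorem map_smul' (φ : A →ₐ[k] B) (h : φ.toRingHom.Etale) (f : A) (s : JetLie k A) :
    map φ h (f • s) = φ f • map φ h s := ext fun l => by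
  obtain ⟨x, hx, -⟩ := exists_rep s (le_refl l)
  simp only [trunc_map, trunc_smul, ← hx, truncSMul_toTrunc, truncMap_toTrunc, SmashLie.map_smul']

theorem anchor_map (φ : A →ₐ[k] B) (h : φ.toRingHom.Etale) (s : JetLie k A) :
    anchor k B (map φ h s) = extendDer φ h (anchor k A s) := by
  obtain ⟨x, hx, -⟩ := exists_rep s (le_refl 0)
  have : ∀ t : JetLie k B, anchor k B t = truncAnchor 0 (trunc 0 t) := fun _ => rfl
  rw [this, trunc_map, ← hx, truncMap_toTrunc]
  have h2 : anchor k A s = truncAnchor 0 (trunc 0 s) := rfl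
  rw [h2, ← hx]
  exact SmashLie.anchor_map φ h x

end JetLie

/-- The homomorphism induced on the completed algebras by an étale homomorphism. -/
noncomputable def AVhat.map (φ : A →ₐ[k] B) (h : φ.toRingHom.Etale) : AVhat k A →ₐ[k] AVhat k B :=
  AVhat.lift ((AVhat.ofFun k B).comp φ) (AVhat.ofJet k B ∘ₗ JetLie.map φ h)
    (fun s t => by simp [JetLie.map_lie, AVhat.ofJet_lie])
    (fun s f => by
      simp [AVhat.ofJet_mul_ofFun, JetLie.anchor_map, extendDer_apply])
    (fun f s => by simp [JetLie.map_smul', AVhat.ofFun_mul_ofJet])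

end Functoriality

section DiffOp
variable (k A : Type u) [CommRing k] [CommRing A] [Algebra k A]

/-- The space of differential operators on `A` of order at most `m` in the sense of Grothendieck. -/
def diffOpOrder : ℕ → Submodule k (Module.End k A)
  | 0 => LinearMap.range (Algebra.lmul k A).toLinearMap
  | m + 1 =>
    { carrier := {T | ∀ g : A, T * Algebra.lmul k A g - Algebra.lmul k A g * T ∈ diffOpOrder m}
      zero_mem' := fun g => by simp
      add_mem' := fun {S T} hS hT g => by
        convert! add_mem (hS g) (hT g) using 1
        simp only [add_mul, mul_add]; abel
      smul_mem' := fun c T hT g => by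
        convert! Submodule.smul_mem _ c (hT g) using 1
        simp only [smul_mul_assoc, mul_smul_comm, smul_sub] }

variable {k A}

theorem mem_diffOpOrder_succ {m : ℕ} {T : Module.End k A} : T ∈ diffOpOrder k A (m + 1) ↔
    ∀ g : A, T * Algebra.lmul k A g - Algebra.lmul k A g * T ∈ diffOpOrder k A m := Iff.rfl

theorem lmul_mem_diffOpOrder (f : A) : Algebra.lmul k A f ∈ diffOpOrder k A 0 := ⟨f, rfl⟩

theorem lmul_comm (f g : A) :
    Algebra.lmul k A f * Algebra.lmul k A g = Algebra.lmul k A g * Algebra.lmul k A f := by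
  rw [← map_mul, ← map_mul, mul_comm]

theorem diffOpOrder_le_succ (m : ℕ) : diffOpOrder k A m ≤ diffOpOrder k A (m + 1) := by
  induction m with
  | zero =>
    rintro _ ⟨f, rfl⟩ g
    simp only [AlgHom.toLinearMap_apply, lmul_comm f g, sub_self, zero_mem]
  | succ m ih => exact fun T hT g => ih (hT g)

theorem diffOpOrder_mono : Monotone (diffOpOrder k A) := monotone_nat_of_le_succ diffOpOrder_le_succ

theorem mul_mem_diffOpOrder {m n : ℕ} {S T : Module.End k A} (hS : S ∈ diffOpOrder k A m)
    (hT : T ∈ diffOpOrder k A n) : S * T ∈ diffOpOrder k A (m + n) := by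
  induction hN : m + n generalizing m n S T with
  | zero =>
    obtain ⟨rfl, rfl⟩ : m = 0 ∧ n = 0 := by omega
    obtain ⟨f, rfl⟩ := hS
    obtain ⟨g, rfl⟩ := hT
    exact ⟨f * g, map_mul (Algebra.lmul k A) f g⟩
  | succ N ih =>
    intro g
    have e : S * T * Algebra.lmul k A g - Algebra.lmul k A g * (S * T) =
        S * (T * Algebra.lmul k A g - Algebra.lmul k A g * T) +
          (S * Algebra.lmul k A g - Algebra.lmul k A g * S) * T := by
      simp only [mul_sub, sub_mul, mul_assoc]; abel
    rw [e]
    refine add_mem ?_ ?_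
    · rcases n with _ | n
      · obtain ⟨f, rfl⟩ := hT
        simp only [AlgHom.toLinearMap_apply, lmul_comm f g, sub_self, mul_zero, zero_mem]
      · exact ih hS (hT g) (by omega)
    · rcases m with _ | m
      · obtain ⟨f, rfl⟩ := hS
        simp only [AlgHom.toLinearMap_apply, lmul_comm f g, sub_self, zero_mul, zero_mem]
      · exact ih (hS g) hT (by omega)

variable (k A) in
/-- The algebra of differential operators on `A`. -/
def DiffOp : Subalgebra k (Module.End k A) where
  carrier := {T | ∃ m, T ∈ diffOpOrder k A m}
  mul_mem' := fun ⟨m, hm⟩ ⟨n, hn⟩ => ⟨m + n, mul_mem_diffOpOrder hm hn⟩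
  add_mem' := fun ⟨m, hm⟩ ⟨n, hn⟩ => ⟨max m n,
    add_mem (diffOpOrder_mono (le_max_left m n) hm) (diffOpOrder_mono (le_max_right m n) hn)⟩
  algebraMap_mem' c := ⟨0, algebraMap k A c, by
    ext; simp [Algebra.smul_def]⟩

namespace DiffOp

variable (k A) in
/-- Multiplication operators. -/
def ofFun : A →ₐ[k] DiffOp k A :=
  (Algebra.lmul k A).codRestrict (DiffOp k A) (fun f => ⟨0, f, rfl⟩)

variable (k A) in
/-- Derivations as differential operators. -/
def ofDer : Derivation k A A →ₗ[k] DiffOp k A where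
  toFun η := ⟨(η : A →ₗ[k] A), 1, fun g => ⟨η g, by ext; simp [mul_comm]⟩⟩
  map_add' _ _ := rfl
  map_smul' _ _ := rfl

end DiffOp
end DiffOp

section TensorModule

/-- Uniformizing parameters `x₁, …, xₙ` of a `k`-algebra `A`, together with the (unique) extensions
of `∂/∂x₁, …, ∂/∂xₙ` to derivations of `A`. -/
structure UniformizingParameters (k A : Type u) [CommRing k] [CommRing A] [Algebra k A]
    (n : ℕ) where
  x : Fin n → A
  algebraicIndependent : AlgebraicIndependent k x
  isAlgebraic : Algebra.IsAlgebraic (Algebra.adjoin k (Set.range x)) A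
  pderiv : Fin n → Derivation k A A
  pderiv_x : ∀ i j, pderiv i (x j) = if i = j then 1 else 0

open SmashLie

variable {k A : Type u} [CommRing k] [CommRing A] [Algebra k A] {n : ℕ}

namespace UniformizingParameters
variable (x : UniformizingParameters k A n)

/-- The map `A # V → A`, `g # η ↦ g ∂(η xᵢ)/∂xⱼ`. -/
noncomputable def jacobian (i j : Fin n) : SmashLie k A →ₗ[k] A :=
  TensorProduct.lift (LinearMap.mk₂ k (fun (g : A) (η : Derivation k A A) => g * x.pderiv j (η (x.x i)))
    (fun _ _ _ => add_mul _ _ _) (fun _ _ _ => smul_mul_assoc _ _ _)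
    (fun _ _ _ => by rw [Derivation.add_apply, map_add, mul_add])
    (fun _ _ _ => by rw [Derivation.smul_apply, Derivation.map_smul, mul_smul_comm]))

@[simp] theorem jacobian_mk (i j : Fin n) (g : A) (η : Derivation k A A) :
    x.jacobian i j (SmashLie.mk g η) = g * x.pderiv j (η (x.x i)) := rfl

theorem jacobian_ofTensor (i j : Fin n) (η : Derivation k A A) (z : A ⊗[k] A) :
    x.jacobian i j (ofTensor η z) = LinearMap.mul' k A z * x.pderiv j (η (x.x i)) +
      LinearMap.mul' k A (LinearMap.lTensor A (x.pderiv j : A →ₗ[k] A) z) * η (x.x i) := by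
  induction z using TensorProduct.induction_on with
  | zero => simp
  | add y z hy hz => simp only [map_add, hy, hz]; ring
  | tmul f g => simp; ring

theorem mul'_lTensor_mul (d : Derivation k A A) (y z : A ⊗[k] A) :
    LinearMap.mul' k A (LinearMap.lTensor A (d : A →ₗ[k] A) (y * z)) =
      LinearMap.mul' k A y * LinearMap.mul' k A (LinearMap.lTensor A (d : A →ₗ[k] A) z) +
      LinearMap.mul' k A z * LinearMap.mul' k A (LinearMap.lTensor A (d : A →ₗ[k] A) y) := by
  induction y using TensorProduct.induction_on with
  | zero => simp
  | add y y' hy hy' => simp only [add_mul, mul_add, map_add, hy, hy']; ring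
  | tmul f g =>
    induction z using TensorProduct.induction_on with
    | zero => simp
    | add y y' hy hy' => simp only [add_mul, mul_add, map_add, hy, hy']; ring
    | tmul f' g' => simp; ring

theorem jacobian_deltaSub (i j : Fin n) {y : SmashLie k A} (hy : y ∈ deltaSub k A 2) :
    x.jacobian i j y = 0 := by
  induction hy using Submodule.span_induction with
  | zero => simp
  | add x y _ _ hx hy => simp [hx, hy]
  | smul c x _ hx => simp [hx]
  | mem y hy =>
    obtain ⟨z, hz, η, rfl⟩ := hy
    have h1 : LinearMap.mul' k A z = 0 :=
      (mem_ideal_iff z).1 (Ideal.pow_le_self two_ne_zero hz)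
    have h2 : LinearMap.mul' k A (LinearMap.lTensor A (x.pderiv j : A →ₗ[k] A) z) = 0 := by
      rw [pow_two] at hz
      clear h1
      induction hz using Submodule.mul_induction_on' with
      | add x _ y _ hx hy => simp only [map_add, hx, hy, add_zero]
      | mem_mul_mem y hy z hz =>
        rw [mul'_lTensor_mul, (mem_ideal_iff y).1 hy, (mem_ideal_iff z).1 hz]; ring
    rw [jacobian_ofTensor, h1, h2, zero_mul, zero_mul, add_zero]

variable (P : Type*) [AddCommGroup P] [Module k P] [Module (DiffOp k A) P]
  [IsScalarTower k (DiffOp k A) P]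
  (W : Type*) [AddCommGroup W] [Module k W] [LieRingModule (Matrix (Fin n) (Fin n) k) W]
  [LieModule k (Matrix (Fin n) (Fin n) k) W]

/-- The action of `A # V` on `P ⊗ W`: for `η = ∑ᵢ fᵢ ∂/∂xᵢ`,
`(g # η) (p ⊗ w) = g η p ⊗ w + ∑ᵢⱼ g (∂fᵢ/∂xⱼ) p ⊗ Eⱼᵢ w`. -/
noncomputable def tensorSmash : SmashLie k A →ₗ[k] Module.End k (P ⊗[k] W) :=
  ((TensorProduct.mapBilinear (RingHom.id k) P W P W).flip LinearMap.id) ∘ₗ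
      (Algebra.lsmul k k P).toLinearMap ∘ₗ DiffOp.ofDer k A ∘ₗ SmashLie.anchor k A +
    ∑ i, ∑ j, ((TensorProduct.mapBilinear (RingHom.id k) P W P W).flip
        (LieModule.toEnd k (Matrix (Fin n) (Fin n) k) W (Matrix.single j i 1))) ∘ₗ
      (Algebra.lsmul k k P).toLinearMap ∘ₗ (DiffOp.ofFun k A).toLinearMap ∘ₗ x.jacobian i j

theorem tensorSmash_mk_tmul (g : A) (η : Derivation k A A) (p : P) (w : W) :
    x.tensorSmash P W (SmashLie.mk g η) (p ⊗ₜ w) =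
      (DiffOp.ofDer k A (g • η) • p) ⊗ₜ[k] w +
        ∑ i, ∑ j, (DiffOp.ofFun k A (g * x.pderiv j (η (x.x i))) • p) ⊗ₜ[k]
          ⁅(Matrix.single j i 1 : Matrix (Fin n) (Fin n) k), w⁆ := by
  simp [tensorSmash, LinearMap.sum_apply, mul_smul]

theorem tensorSmash_deltaSub {y : SmashLie k A} (hy : y ∈ deltaSub k A 2) :
    x.tensorSmash P W y = 0 := by
  simp [tensorSmash, x.jacobian_deltaSub _ _ hy, anchor_deltaSub hy]

/-- The action of jets of vector fields on `T(P, W) = P ⊗ W`, where the `gl n`-module `W` is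
regarded as a module over `m Der(k⟦X₁, …, Xₙ⟧)` on which `m² Der(k⟦X₁, …, Xₙ⟧)` acts by zero and
`Xⱼ ∂/∂Xᵢ` acts as `Eⱼᵢ`. -/
noncomputable def tensorJet : JetLie k A →ₗ[k] Module.End k (P ⊗[k] W) :=
  Submodule.liftQ _ (x.tensorSmash P W) (fun _ hy => x.tensorSmash_deltaSub P W hy) ∘ₗ
    JetLie.trunc 1

theorem tensorJet_of (y : SmashLie k A) :
    x.tensorJet P W (JetLie.of k A y) = x.tensorSmash P W y := rfl

end UniformizingParameters

/-- The action of `A` on `T(P, W) = P ⊗ W` in the left factor. -/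
noncomputable def tensorFun (P : Type*) [AddCommGroup P] [Module k P] [Module (DiffOp k A) P]
    [IsScalarTower k (DiffOp k A) P] (W : Type*) [AddCommGroup W] [Module k W] (f : A) : Module.End k (P ⊗[k] W) :=
  LinearMap.rTensor W (Algebra.lsmul k k P (DiffOp.ofFun k A f))

variable (k n) in
/-- `W` is isomorphic, as a `gl n`-module, to the exterior power `⋀ⁱ(kⁿ)` of the natural
representation; an element `X` of `gl n` acts on the latter by
`X (v₁ ∧ ⋯ ∧ vᵢ) = ∑ⱼ v₁ ∧ ⋯ ∧ X vⱼ ∧ ⋯ ∧ vᵢ`. -/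
def IsExteriorPower (i : ℕ) (W : Type*) [AddCommGroup W] [Module k W]
    [LieRingModule (Matrix (Fin n) (Fin n) k) W] : Prop :=
  ∃ e : ⋀[k]^i (Fin n → k) ≃ₗ[k] W, ∀ (X : Matrix (Fin n) (Fin n) k) (v : Fin i → Fin n → k),
    ⁅X, e (exteriorPower.ιMulti k i v)⁆ =
      ∑ j, e (exteriorPower.ιMulti k i (Function.update v j (X.mulVec (v j))))

end TensorModule

section Geometry
open AlgebraicGeometry CategoryTheory

attribute [local instance] MvPolynomial.gradedAlgebra

/-- A smooth irreducible quasi-projective variety of dimension `n` over `k`. -/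
structure SmoothVariety (k : Type u) [Field k] (n : ℕ) where
  scheme : Scheme.{u}
  toBase : scheme ⟶ Spec (CommRingCat.of k)
  integral : IsIntegral scheme
  smooth : SmoothOfRelativeDimension n toBase
  quasiProjective : ∃ (m : ℕ) (i : scheme ⟶ Proj (MvPolynomial.homogeneousSubmodule (Fin (m + 1)) k)),
    IsImmersion i ∧ i ≫ Proj.toSpecZero _ ≫ Spec.map (CommRingCat.ofHom
      (algebraMap k (MvPolynomial.homogeneousSubmodule (Fin (m + 1)) k 0))) = toBase

variable {k : Type u} [Field k] {n : ℕ}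

namespace SmoothVariety
variable (X : SmoothVariety k n)

noncomputable instance (U : X.scheme.Opens) : Algebra k Γ(X.scheme, U) :=
  ((Scheme.ΓSpecIso (CommRingCat.of k)).inv ≫ X.toBase.appTop ≫
    X.scheme.presheaf.map (homOfLE le_top).op).hom.toAlgebra

noncomputable instance (M : X.scheme.Modules) (U : X.scheme.Opens) : Module k Γ(M, U) :=
  Module.compHom _ (algebraMap k Γ(X.scheme, U))

variable {X}

/-- Restriction of regular functions. -/
noncomputable def res {U V : X.scheme.Opens} (h : V ≤ U) :
    Γ(X.scheme, U) →ₐ[k] Γ(X.scheme, V) where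
  __ := (X.scheme.presheaf.map (homOfLE h).op).hom
  commutes' c := by
    change (X.scheme.presheaf.map (homOfLE h).op).hom (((Scheme.ΓSpecIso (CommRingCat.of k)).inv ≫
      X.toBase.appTop ≫ X.scheme.presheaf.map (homOfLE le_top).op).hom c) = _
    rw [← CommRingCat.comp_apply, Category.assoc, Category.assoc, ← Functor.map_comp]
    rfl

/-- Restriction of sections. -/
noncomputable def resSec (M : X.scheme.Modules) {U V : X.scheme.Opens} (h : V ≤ U) :
    Γ(M, U) →ₗ[k] Γ(M, V) where
  __ := (M.presheaf.map (homOfLE h).op).hom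
  map_smul' c m := by
    have : (M.presheaf.map (homOfLE h).op) (algebraMap k Γ(X.scheme, U) c • m) =
        (res h (algebraMap k Γ(X.scheme, U) c)) • (M.presheaf.map (homOfLE h).op) m :=
      M.map_smul (homOfLE h) _ m
    rw [AlgHom.commutes] at this
    exact this

theorem resSec_resSec (M : X.scheme.Modules) {U V V' : X.scheme.Opens} (h : V ≤ U) (h' : V' ≤ V)
    (m : Γ(M, U)) : resSec M h' (resSec M h m) = resSec M (h'.trans h) m := by
  change ((M.presheaf.map (homOfLE h).op) ≫ (M.presheaf.map (homOfLE h').op)) m =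
    (M.presheaf.map (homOfLE (h'.trans h)).op) m
  rw [← Functor.map_comp]
  rfl

end SmoothVariety

/-- An étale chart of `X`: an affine open set that admits uniformizing parameters. -/
structure EtaleChart (X : SmoothVariety k n) where
  carrier : X.scheme.Opens
  isAffineOpen : IsAffineOpen carrier
  nonempty_parameters : Nonempty (UniformizingParameters k Γ(X.scheme, carrier) n)

namespace EtaleChart
variable {X : SmoothVariety k n}

/-- The algebra of regular functions on an étale chart. -/
abbrev Fun (U : EtaleChart X) : Type u := Γ(X.scheme, U.carrier)

/-- The Lie algebra `Θ(U) = Der(𝒪(U))` of vector fields on an étale chart. -/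
abbrev Vec (U : EtaleChart X) : Type u := Derivation k U.Fun U.Fun

/-- The algebra of sections of the sheaf `ÂV` on an étale chart. -/
abbrev AVhatSec (U : EtaleChart X) : Type u := AVhat k U.Fun

theorem res_etale {U V : EtaleChart X} (h : V.carrier ≤ U.carrier) :
    (SmoothVariety.res h).toRingHom.Etale := by
  have := Scheme.Hom.etale_appLE (𝟙 X.scheme) U.isAffineOpen V.isAffineOpen h
  have e : (𝟙 X.scheme :).appLE U.carrier V.carrier h = X.scheme.presheaf.map (homOfLE h).op := by
    simp [Scheme.Hom.appLE]
    rfl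
  rw [e] at this
  exact this

/-- Restriction `ÂV(U) → ÂV(V)`. -/
noncomputable def resAVhat {U V : EtaleChart X} (h : V.carrier ≤ U.carrier) :
    U.AVhatSec →ₐ[k] V.AVhatSec :=
  AVhat.map (SmoothVariety.res h) (res_etale h)

end EtaleChart

/-- An `ÂV`-module on `X`: a quasi-coherent sheaf with actions of the algebras `ÂV(U)` on the
sections on étale charts (which form a base of the topology of `X`), which extend the actions of
`𝒪(U)` and are compatible with restrictions. -/
structure AVhatModule (X : SmoothVariety k n) where
  sheaf : X.scheme.Modules
  isQuasicoherent : sheaf.IsQuasicoherent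
  act (U : EtaleChart X) : U.AVhatSec →ₐ[k] Module.End k Γ(sheaf, U.carrier)
  act_ofFun (U : EtaleChart X) (f : U.Fun) (m : Γ(sheaf, U.carrier)) :
    act U (AVhat.ofFun k U.Fun f) m = f • m
  act_res (U V : EtaleChart X) (h : V.carrier ≤ U.carrier) (a : U.AVhatSec)
    (m : Γ(sheaf, U.carrier)) : SmoothVariety.resSec sheaf h (act U a m) =
      act V (EtaleChart.resAVhat h a) (SmoothVariety.resSec sheaf h m)

namespace AVhatModule
variable {X : SmoothVariety k n} (M : AVhatModule X)

/-- The sections of an `ÂV`-module on an étale chart. -/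
def Sec (U : EtaleChart X) : Type u := Γ(M.sheaf, U.carrier)

variable (U : EtaleChart X)

noncomputable instance : AddCommGroup (M.Sec U) := inferInstanceAs (AddCommGroup Γ(M.sheaf, U.carrier))
noncomputable instance : Module k (M.Sec U) := inferInstanceAs (Module k Γ(M.sheaf, U.carrier))
noncomputable instance : Module U.AVhatSec (M.Sec U) :=
  Module.compHom Γ(M.sheaf, U.carrier) (M.act U).toRingHom

instance : IsScalarTower k U.AVhatSec (M.Sec U) where
  smul_assoc c a m := congrArg (fun T : Module.End k Γ(M.sheaf, U.carrier) => T m)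
    (map_smul (M.act U) c a)

instance : SMulCommClass k U.AVhatSec (M.Sec U) where
  smul_comm c a m := ((M.act U a).map_smul c m).symm

/-- Vector fields act on sections through their images in `ÂV(U)`. -/
noncomputable instance : LieRingModule U.Vec (M.Sec U) where
  bracket η m := AVhat.ofDer k U.Fun η • m
  add_lie η μ m := by rw [map_add, add_smul]
  lie_add η m m' := smul_add _ _ _
  leibniz_lie η μ m := by
    rw [AVhat.ofDer_lie, sub_smul, mul_smul, mul_smul]; abel

theorem lie_def (η : U.Vec) (m : M.Sec U) : ⁅η, m⁆ = AVhat.ofDer k U.Fun η • m := rfl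

noncomputable instance : LieModule k U.Vec (M.Sec U) where
  smul_lie c η m := by rw [lie_def, lie_def, map_smul, smul_assoc]
  lie_smul c η m := by rw [lie_def, lie_def, smul_comm]

/-- `M` is simple: it is nonzero, its only (quasi-coherent) `ÂV`-subsheaves are `0` and `M`, and
for each étale chart `U`, `M(U)` is zero or a simple `ÂV(U)`-module. -/
def IsSimple : Prop :=
  ¬ Limits.IsZero M.sheaf ∧
  (∀ (N : X.scheme.Modules) (i : N ⟶ M.sheaf), N.IsQuasicoherent → Mono i →
    (∀ (U : EtaleChart X) (a : U.AVhatSec) (m : Γ(N, U.carrier)),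
      ∃ m' : Γ(N, U.carrier), i.app U.carrier m' = M.act U a (i.app U.carrier m)) →
    Limits.IsZero N ∨ IsIso i) ∧
  ∀ U : EtaleChart X, Subsingleton (M.Sec U) ∨ IsSimpleModule U.AVhatSec (M.Sec U)

/-- Restriction of sections from an étale chart to a smaller open set. -/
noncomputable def resTo {V : X.scheme.Opens} (h : V ≤ U.carrier) :
    M.Sec U →ₗ[k] Γ(M.sheaf, V) :=
  SmoothVariety.resSec M.sheaf h

theorem resTo_eq_zero {V V' : X.scheme.Opens} (h : V ≤ U.carrier) (h' : V' ≤ V) {m : M.Sec U}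
    (hm : M.resTo U h m = 0) : M.resTo U (h'.trans h) m = 0 := by
  have : M.resTo U (h'.trans h) m = SmoothVariety.resSec M.sheaf h' (M.resTo U h m) :=
    (SmoothVariety.resSec_resSec M.sheaf h h' m).symm
  rw [this, hm, map_zero]

/-- The sections on an étale chart whose germ at `p` is zero. -/
def zeroGerm (p : U.carrier) : Submodule k (M.Sec U) where
  carrier := {m | ∃ (V : X.scheme.Opens) (h : V ≤ U.carrier), p.1 ∈ V ∧ M.resTo U h m = 0}
  zero_mem' := ⟨U.carrier, le_refl _, p.2, map_zero _⟩
  add_mem' := fun ⟨V, h, hp, hm⟩ ⟨V', h', hp', hm'⟩ =>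
    ⟨V ⊓ V', inf_le_left.trans h, ⟨hp, hp'⟩, by
      rw [map_add, M.resTo_eq_zero U h inf_le_left hm, M.resTo_eq_zero U h' inf_le_right hm',
        add_zero]⟩
  smul_mem' c _ := fun ⟨V, h, hp, hm⟩ => ⟨V, h, hp, by rw [map_smul, hm, smul_zero]⟩

/-- The Gelfand-Kirillov dimension of `M`: the supremum over `p` of the Gelfand-Kirillov dimension
of the stalk `M_p` over the stalk `ÂV_p`, i.e. of the upper limits of `log_l dim (F ^ l M₀)`, where
`F ⊆ ÂV_p` is a finite-dimensional subspace containing `1` and `M₀ ⊆ M_p` is a finite-dimensional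
subspace. Such `F` and `M₀` are represented by subspaces of `ÂV(U)` and `M(U)` for an étale chart
`U` containing `p`, and `F ^ l M₀ ⊆ M_p` is the image of their product. -/
noncomputable def gkDim : EReal :=
  ⨆ (U : EtaleChart X) (p : U.carrier)
    (F : Submodule k U.AVhatSec) (_ : F.FG ∧ 1 ∈ F) (M₀ : Submodule k (M.Sec U)) (_ : M₀.FG),
    Filter.limsup (fun l : ℕ => ((Real.logb l
      (Module.finrank k ((F ^ l • M₀).map (M.zeroGerm U p).mkQ)) : ℝ) : EReal)) Filter.atTop

/-- `M` is holonomic: it is locally finitely generated of Gelfand-Kirillov dimension `n = dim X`,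
or it is zero. -/
def IsHolonomic : Prop :=
  ((∀ p : X.scheme, ∃ U : EtaleChart X, p ∈ U.carrier ∧ Module.Finite U.AVhatSec (M.Sec U)) ∧
    M.gkDim = n) ∨ Limits.IsZero M.sheaf

/-- `M` is of type `W`: for each étale chart `U` there is a module `P` over the algebra of
differential operators on `U` such that `M(U) ≅ T(P, W)` as `ÂV(U)`-modules. -/
def IsOfType (W : Type*) [AddCommGroup W] [Module k W]
    [LieRingModule (Matrix (Fin n) (Fin n) k) W] [LieModule k (Matrix (Fin n) (Fin n) k) W] : Prop :=
  ∀ U : EtaleChart X, ∃ (x : UniformizingParameters k U.Fun n) (P : Type u) (_ : AddCommGroup P)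
    (_ : Module k P) (_ : Module (DiffOp k U.Fun) P) (_ : IsScalarTower k (DiffOp k U.Fun) P)
    (e : P ⊗[k] W ≃ₗ[k] M.Sec U),
    (∀ (f : U.Fun) (t : P ⊗[k] W), e (tensorFun P W f t) = AVhat.ofFun k U.Fun f • e t) ∧
    ∀ (s : JetLie k U.Fun) (t : P ⊗[k] W), e (x.tensorJet P W s t) = AVhat.ofJet k U.Fun s • e t

end AVhatModule
end Geometry

/-! Over an étale chart, `M.Sec U` is `P ⊗ W`: functions act on `P`, and a vector field acts on `P`
with a correction in which the first derivatives of its coefficients multiply the elementary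
matrices $E_{ji}$ on $W$. A subspace $N$ stable under vector fields need not be stable under
functions, so simplicity over `AVhat` does not apply to $N$ directly. The remedy is to study the
operators $q$ on $W$ for which $f\otimes q$ preserves $N$ for every function $f$ (`stabilizingEnd`).

Two facts carry the argument. Distribute $x_a$ and $x_c$ over the two factors of
$(h\,\partial_b)\cdot\partial_d$ in all four ways, with signs. The resulting combination of products
of two vector fields is zero as a differential operator, so on $P\otimes W$ only the contribution of
$W$ survives. It is $h\otimes q$ with
$q=\delta_{ab}E_{cd}+\delta_{bc}E_{ad}-E_{ab}E_{cd}-E_{cb}E_{ad}$, and $h$ is arbitrary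
(`tensorFun_mul_exteriorDefect`). Moreover, commutators with $\mathfrak{gl}_n$ preserve the set of
stabilizing operators (`commutator_mem_stabilizingEnd`).

Consequently the vectors $(f\otimes q)t$, with $q$ stabilizing and $t\in N$, span a subspace of $N$
that is stable under functions and vector fields, hence under `AVhat`. By simplicity this span is
everything, and then so is $N$, or it is zero. In the latter case the common kernel of the
stabilizing operators is a $\mathfrak{gl}_n$-submodule of $W$. If it is $0$, then $N=0$. If it is
$W$, all the quadratic operators above vanish on $W$ (`eq_bot_or_eq_top_of_tensorDer`).

That vanishing identifies $W$ as an exterior power. It gives $E_{ii}^2=E_{ii}$, so there is a common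
eigenvector of the $E_{ii}$ whose weight is the indicator of a set $S$, and eigenvalues outside
$\{0,1\}$ are excluded (`exists_vacuum`). The wedge of the $e_s$, $s\in S$, is a vector of the same
kind in $\Lambda^{|S|}$, and two irreducible modules with such vectors for the same $S$ are
isomorphic (`exists_equiv_of_vacuum`). -/

section GlFamily

/-! ### Irreducible $\mathfrak{gl}_n$-modules with a vacuum vector -/

/-- Operators `E a b` satisfying the commutation relations of the elementary matrices. -/
def IsGlFamily {ι R : Type*} [DecidableEq ι] [Ring R] (E : ι → ι → R) : Prop :=
  ∀ a b c d, E a b * E c d = E c d * E a b + (if b = c then E a d else 0) -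
    (if a = d then E c b else 0)

theorem IsGlFamily.of_sub {ι R : Type*} [DecidableEq ι] [Ring R] {E : ι → ι → R}
    (h : ∀ a b c d, E a b * E c d - E c d * E a b =
      (if b = c then E a d else 0) - (if a = d then E c b else 0)) : IsGlFamily E :=
  fun a b c d => (sub_eq_iff_eq_add'.1 (h a b c d)).trans (add_sub_assoc _ _ _).symm

/-- A family of operators without nontrivial common invariant subspaces. -/
def IsIrreducibleFamily (k : Type*) {ι M : Type*} [Field k] [AddCommGroup M] [Module k M]
    (E : ι → ι → Module.End k M) : Prop :=
  ∀ K : Submodule k M, (∀ a b, ∀ x ∈ K, E a b x ∈ K) → K = ⊥ ∨ K = ⊤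

/-- `z` is a vector of the weight given by the indicator function of `S`, annihilated by all
`E a b` with `a ≠ b` and `a ∈ S` or `b ∉ S`. -/
def IsVacuum {k ι M : Type*} [DecidableEq ι] [Field k] [AddCommGroup M] [Module k M]
    (E : ι → ι → Module.End k M) (S : Finset ι) (z : M) : Prop :=
  ∀ a b, (a ∈ S ∨ b ∉ S) → E a b z = if a = b ∧ a ∈ S then z else 0

variable {k : Type*} [Field k] {ι : Type*} [DecidableEq ι]
variable {M : Type*} [AddCommGroup M] [Module k M]

theorem IsGlFamily.apply {E : ι → ι → Module.End k M} (hE : IsGlFamily E) (a b c d : ι) (y : M) :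
    E a b (E c d y) = E c d (E a b y) + (if b = c then E a d y else 0) -
      (if a = d then E c b y else 0) := by
  have := congrArg (fun T : Module.End k M => T y) (hE a b c d)
  simp only [Module.End.mul_apply, LinearMap.sub_apply, LinearMap.add_apply] at this
  rw [this]
  split_ifs <;> rfl

/-- The span of the vectors `E t₁ s₁ ⋯ E tᵣ sᵣ z` with `tᵢ ∉ S`, `sᵢ ∈ S`. -/
def lowering (E : ι → ι → Module.End k M) (S : Finset ι) (z : M) : ℕ → Submodule k M
  | 0 => Submodule.span k {z}
  | r + 1 => Submodule.span k
      {v | ∃ t, t ∉ S ∧ ∃ s, s ∈ S ∧ ∃ y ∈ lowering E S z r, E t s y = v}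

variable {E : ι → ι → Module.End k M} {S : Finset ι} {z : M}

theorem mem_lowering_zero : z ∈ lowering E S z 0 := Submodule.mem_span_singleton_self z

theorem mem_lowering_succ {r : ℕ} {t s : ι} (ht : t ∉ S) (hs : s ∈ S) {y : M}
    (hy : y ∈ lowering E S z r) : E t s y ∈ lowering E S z (r + 1) :=
  Submodule.subset_span ⟨t, ht, s, hs, y, hy, rfl⟩

/-- A set $S$ grades $\mathfrak{gl}_n$ in degrees $-1,0,1$. Here $E_{ab}$ has degree $0$, so its
commutator with a lowering operator is again a combination of lowering operators. -/
theorem lowering_stable_levi (hE : IsGlFamily E) (hz : IsVacuum E S z) {a b : ι}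
    (hab : a ∈ S ↔ b ∈ S) {r : ℕ} {y : M} (hy : y ∈ lowering E S z r) :
    E a b y ∈ lowering E S z r := by
  induction r generalizing y with
  | zero =>
    obtain ⟨c, rfl⟩ := Submodule.mem_span_singleton.1 hy
    rw [map_smul]
    refine Submodule.smul_mem _ c ?_
    rw [hz a b (by tauto)]
    split_ifs
    exacts [mem_lowering_zero, zero_mem _]
  | succ r ih =>
    rw [lowering] at hy
    induction hy using Submodule.span_induction with
    | zero => rw [map_zero]; exact zero_mem _
    | add x y _ _ hx hy => rw [map_add]; exact add_mem hx hy
    | smul c x _ hx => rw [map_smul]; exact Submodule.smul_mem _ c hx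
    | mem x hx =>
      obtain ⟨t, ht, s, hs, y, hy, rfl⟩ := hx
      rw [hE.apply]
      refine sub_mem (add_mem (mem_lowering_succ ht hs (ih hy)) ?_) ?_
      · split_ifs with h
        · exact mem_lowering_succ (by rw [hab, h]; exact ht) hs hy
        · exact zero_mem _
      · split_ifs with h
        · exact mem_lowering_succ ht (by rw [← hab, h]; exact hs) hy
        · exact zero_mem _

/-- This makes the span of the lowered vectors the submodule generated by $z$. Only raising
operators need an argument: they kill $z$, and their commutator with a lowering operator has degree
$0$. -/
theorem iSup_lowering_stable (hE : IsGlFamily E) (hz : IsVacuum E S z) (a b : ι) {y : M}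
    (hy : y ∈ ⨆ r, lowering E S z r) : E a b y ∈ ⨆ r, lowering E S z r := by
  have hle : ∀ r, lowering E S z r ≤ ⨆ r, lowering E S z r := le_iSup _
  have hlow : ∀ t s, t ∉ S → s ∈ S → ∀ y ∈ ⨆ r, lowering E S z r,
      E t s y ∈ ⨆ r, lowering E S z r := by
    intro t s ht hs y hy
    induction hy using Submodule.iSup_induction' with
    | mem r x hx => exact hle _ (mem_lowering_succ ht hs hx)
    | zero => rw [map_zero]; exact zero_mem _
    | add x y _ _ hx hy => rw [map_add]; exact add_mem hx hy
  induction hy using Submodule.iSup_induction' with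
  | zero => rw [map_zero]; exact zero_mem _
  | add x y _ _ hx hy => rw [map_add]; exact add_mem hx hy
  | mem r x hx =>
    by_cases hab : a ∈ S ↔ b ∈ S
    · exact hle r (lowering_stable_levi hE hz hab hx)
    by_cases ha : a ∈ S
    swap
    · exact hlow a b ha (by tauto) x (hle r hx)
    have hb : b ∉ S := by tauto
    -- The raising case, $a\in S$ and $b\notin S$: induct on the number of lowering operators.
    clear hab
    induction r generalizing x with
    | zero =>
      obtain ⟨c, rfl⟩ := Submodule.mem_span_singleton.1 hx
      have : ¬ (a = b ∧ a ∈ S) := by rintro ⟨rfl, h⟩; exact hb h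
      rw [map_smul, hz a b (.inl ha), if_neg this, smul_zero]
      exact zero_mem _
    | succ r ih =>
      rw [lowering] at hx
      induction hx using Submodule.span_induction with
      | zero => rw [map_zero]; exact zero_mem _
      | add x y _ _ hx hy => rw [map_add]; exact add_mem hx hy
      | smul c x _ hx => rw [map_smul]; exact Submodule.smul_mem _ c hx
      | mem x hx =>
        obtain ⟨t, ht, s, hs, y, hy, rfl⟩ := hx
        rw [hE.apply]
        refine sub_mem (add_mem (hlow t s ht hs _ (ih y hy)) ?_) ?_
        · split_ifs with h
          · exact hle r (lowering_stable_levi hE hz (by tauto) hy)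
          · exact zero_mem _
        · split_ifs with h
          · exact hle r (lowering_stable_levi hE hz (by tauto) hy)
          · exact zero_mem _

/-- The element $\sum_{s\in S}E_{ss}$ is the grading operator: its value on $z$ is $|S|$, and each
$E_{ts}$ with $s\in S$, $t\notin S$ decreases it by one. -/
theorem lowering_eigen (hE : IsGlFamily E) (hz : IsVacuum E S z) {r : ℕ} {y : M}
    (hy : y ∈ lowering E S z r) :
    (∑ s ∈ S, E s s) y = ((S.card : k) - r) • y := by
  induction r generalizing y with
  | zero =>
    obtain ⟨c, rfl⟩ := Submodule.mem_span_singleton.1 hy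
    have : (∑ s ∈ S, E s s) z = (S.card : k) • z := by
      rw [LinearMap.sum_apply, Finset.sum_congr rfl (fun s hs => hz s s (.inl hs))]
      rw [Finset.sum_congr rfl (fun s hs => if_pos ⟨rfl, hs⟩), Finset.sum_const, Nat.cast_smul_eq_nsmul]
    rw [map_smul, this, Nat.cast_zero, sub_zero, smul_comm]
  | succ r ih =>
    rw [lowering] at hy
    induction hy using Submodule.span_induction with
    | zero => rw [map_zero, smul_zero]
    | add x y _ _ hx hy => rw [map_add, hx, hy, smul_add]
    | smul c x _ hx => rw [map_smul, hx, smul_comm]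
    | mem x hx =>
      obtain ⟨t, ht, s, hs, y, hy, rfl⟩ := hx
      have h1 : ∀ i ∈ S, E i i (E t s y) = E t s (E i i y) - if i = s then E t s y else 0 := by
        intro i hi
        have hit : i ≠ t := fun h => ht (h ▸ hi)
        rw [hE.apply, if_neg hit, add_zero]
        split_ifs with h
        · rw [h]
        · rfl
      have h2 := ih hy
      rw [LinearMap.sum_apply] at h2 ⊢
      rw [Finset.sum_congr rfl h1, Finset.sum_sub_distrib, Finset.sum_ite_eq' S s, if_pos hs,
        ← map_sum, h2, map_smul]
      push_cast
      module

/-- In characteristic $0$ the eigenvalues $|S|-r$ with $r\ge 1$ differ from $|S|$. Independence of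
eigenspaces then leaves only the layer $r=0$, which is spanned by $z$. -/
theorem mem_span_of_eigen [CharZero k] (hE : IsGlFamily E) (hz : IsVacuum E S z) {y : M}
    (hy : y ∈ ⨆ r, lowering E S z r) (h : (∑ s ∈ S, E s s) y = (S.card : k) • y) :
    y ∈ Submodule.span k {z} := by
  set H := ∑ s ∈ S, E s s with hH
  have hle : ∀ r, lowering E S z r ≤ H.eigenspace ((S.card : k) - r) := fun r x hx =>
    Module.End.mem_eigenspace_iff.2 (lowering_eigen hE hz hx)
  have hsup : (⨆ r, lowering E S z r) ≤
      lowering E S z 0 ⊔ ⨆ μ, ⨆ _ : μ ≠ (S.card : k), H.eigenspace μ := by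
    refine iSup_le fun r => ?_
    rcases r with _ | r
    · exact le_sup_left
    · refine le_trans (hle _) (le_trans ?_ le_sup_right)
      refine le_iSup₂_of_le ((S.card : k) - ((r + 1 : ℕ) : k)) ?_ le_rfl
      rw [Ne, sub_eq_self]
      exact Nat.cast_ne_zero.2 (Nat.succ_ne_zero r)
  obtain ⟨c, hc, d, hd, rfl⟩ := Submodule.mem_sup.1 (hsup hy)
  have hc' : H c = (S.card : k) • c := by
    have := lowering_eigen hE hz hc
    rwa [Nat.cast_zero, sub_zero] at this
  have hd' : d ∈ H.eigenspace (S.card : k) := by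
    rw [Module.End.mem_eigenspace_iff]
    rw [map_add, smul_add, hc'] at h
    exact add_left_cancel h
  have := (Module.End.eigenspaces_iSupIndep H (S.card : k)).le_bot ⟨hd', hd⟩
  rw [(Submodule.mem_bot k).1 this, add_zero]
  exact hc

variable {L : Type*} [AddCommGroup L] [Module k L]

/-- Two irreducible families with vacuum vectors of the same weight are isomorphic. -/
theorem exists_equiv_of_vacuum [CharZero k] {F : ι → ι → Module.End k L} (hE : IsGlFamily E)
    (hF : IsGlFamily F) (hEi : IsIrreducibleFamily k E) (hFi : IsIrreducibleFamily k F)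
    {l : L} (hz : IsVacuum E S z) (hl : IsVacuum F S l) (hz0 : z ≠ 0) (hl0 : l ≠ 0) :
    ∃ e : L ≃ₗ[k] M, ∀ a b x, e (F a b x) = E a b (e x) := by
  -- A Goursat argument: the submodule $Z$ of $L\times M$ generated by $(l,z)$ will be the graph of
  -- the isomorphism.
  let G : ι → ι → Module.End k (L × M) := fun a b => (F a b).prodMap (E a b)
  have hG : IsGlFamily G := by
    intro a b c d
    refine LinearMap.ext fun x => Prod.ext ?_ ?_
    · have := hF.apply a b c d x.1
      simp only [G, Module.End.mul_apply, LinearMap.sub_apply, LinearMap.add_apply,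
        LinearMap.prodMap_apply, Prod.fst_sub, Prod.fst_add, this]
      split_ifs <;> rfl
    · have := hE.apply a b c d x.2
      simp only [G, Module.End.mul_apply, LinearMap.sub_apply, LinearMap.add_apply,
        LinearMap.prodMap_apply, Prod.snd_sub, Prod.snd_add, this]
      split_ifs <;> rfl
  have hv : IsVacuum G S (l, z) := by
    intro a b hab
    simp only [G, LinearMap.prodMap_apply, hz a b hab, hl a b hab]
    split_ifs <;> rfl
  set Z : Submodule k (L × M) := ⨆ r, lowering G S (l, z) r with hZ
  have hZs : ∀ a b, ∀ x ∈ Z, G a b x ∈ Z := fun a b x hx => iSup_lowering_stable hG hv a b hx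
  have hmem : (l, z) ∈ Z := le_iSup (lowering G S (l, z)) 0 mem_lowering_zero
  have hHl : (∑ s ∈ S, F s s) l = (S.card : k) • l := by
    simpa using lowering_eigen hF hl (r := 0) mem_lowering_zero
  have hHz : (∑ s ∈ S, E s s) z = (S.card : k) • z := by
    simpa using lowering_eigen hE hz (r := 0) mem_lowering_zero
  have hH : ∀ x, (∑ s ∈ S, G s s) x = ((∑ s ∈ S, F s s) x.1, (∑ s ∈ S, E s s) x.2) := by
    intro x
    simp only [LinearMap.sum_apply, G, LinearMap.prodMap_apply]
    refine Prod.ext ?_ ?_ <;> simp [Prod.fst_sum, Prod.snd_sum]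
  -- In $Z$ the eigenvalue $|S|$ occurs only on multiples of $(l,z)$, and $(l,0)$ is not such a
  -- multiple.
  have hnl : (l, (0 : M)) ∉ Z := by
    intro h
    have := mem_span_of_eigen hG hv h (by rw [hH]; simp [hHl])
    obtain ⟨c, hc⟩ := Submodule.mem_span_singleton.1 this
    simp only [Prod.smul_mk, Prod.mk.injEq, smul_eq_zero, hz0, or_false] at hc
    exact hl0 (by rw [← hc.1, hc.2, zero_smul])
  have hnz : ((0 : L), z) ∉ Z := by
    intro h
    have := mem_span_of_eigen hG hv h (by rw [hH]; simp [hHz])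
    obtain ⟨c, hc⟩ := Submodule.mem_span_singleton.1 this
    simp only [Prod.smul_mk, Prod.mk.injEq, smul_eq_zero, hl0, or_false] at hc
    exact hz0 (by rw [← hc.2, hc.1, zero_smul])
  -- By irreducibility, $Z$ meets each factor trivially and projects onto each factor.
  have hk1 : Z.comap (LinearMap.inl k L M) = ⊥ := by
    refine (hFi _ fun a b x hx => ?_).resolve_right fun h => hnl ?_
    · have := hZs a b _ hx
      simpa [G] using this
    · have : l ∈ Z.comap (LinearMap.inl k L M) := h ▸ Submodule.mem_top
      exact this
  have hk2 : Z.comap (LinearMap.inr k L M) = ⊥ := by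
    refine (hEi _ fun a b x hx => ?_).resolve_right fun h => hnz ?_
    · have := hZs a b _ hx
      simpa [G] using this
    · have : z ∈ Z.comap (LinearMap.inr k L M) := h ▸ Submodule.mem_top
      exact this
  have hr1 : Z.map (LinearMap.fst k L M) = ⊤ := by
    refine (hFi _ ?_).resolve_left fun h => hl0 ?_
    · rintro a b _ ⟨x, hx, rfl⟩
      exact ⟨_, hZs a b x hx, rfl⟩
    · have : l ∈ Z.map (LinearMap.fst k L M) := ⟨_, hmem, rfl⟩
      rwa [h] at this
  have hr2 : Z.map (LinearMap.snd k L M) = ⊤ := by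
    refine (hEi _ ?_).resolve_left fun h => hz0 ?_
    · rintro a b _ ⟨x, hx, rfl⟩
      exact ⟨_, hZs a b x hx, rfl⟩
    · have : z ∈ Z.map (LinearMap.snd k L M) := ⟨_, hmem, rfl⟩
      rwa [h] at this
  let e₁ : Z ≃ₗ[k] L := LinearEquiv.ofBijective (LinearMap.fst k L M ∘ₗ Z.subtype) <| by
    constructor
    · rw [injective_iff_map_eq_zero]
      rintro ⟨⟨x, y⟩, h⟩ (rfl : x = 0)
      have : y ∈ Z.comap (LinearMap.inr k L M) := h
      rw [hk2, Submodule.mem_bot] at this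
      subst this
      rfl
    · intro x
      obtain ⟨y, hy, rfl⟩ := (hr1 ▸ Submodule.mem_top : x ∈ Z.map (LinearMap.fst k L M))
      exact ⟨⟨y, hy⟩, rfl⟩
  let e₂ : Z ≃ₗ[k] M := LinearEquiv.ofBijective (LinearMap.snd k L M ∘ₗ Z.subtype) <| by
    constructor
    · rw [injective_iff_map_eq_zero]
      rintro ⟨⟨x, y⟩, h⟩ (rfl : y = 0)
      have : x ∈ Z.comap (LinearMap.inl k L M) := h
      rw [hk1, Submodule.mem_bot] at this
      subst this
      rfl
    · intro x
      obtain ⟨y, hy, rfl⟩ := (hr2 ▸ Submodule.mem_top : x ∈ Z.map (LinearMap.snd k L M))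
      exact ⟨⟨y, hy⟩, rfl⟩
  refine ⟨e₁.symm.trans e₂, fun a b x => ?_⟩
  obtain ⟨y, rfl⟩ := e₁.surjective x
  have h : F a b (e₁ y) = e₁ ⟨G a b y, hZs a b y y.2⟩ := rfl
  rw [h]
  simp only [LinearEquiv.trans_apply, LinearEquiv.symm_apply_apply]
  rfl

/-- A nonzero subspace stable under commuting idempotents contains a common eigenvector. -/
theorem exists_common_eigenvector {p : ι → Module.End k M} (hp : ∀ i, p i * p i = p i)
    (hc : ∀ i j, Commute (p i) (p j)) {K : Submodule k M} (hK : K ≠ ⊥)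
    (hs : ∀ i, ∀ x ∈ K, p i x ∈ K) (T : Finset ι) :
    ∃ x ∈ K, x ≠ 0 ∧ ∀ i ∈ T, p i x = 0 ∨ p i x = x := by
  induction T using Finset.induction_on with
  | empty =>
    obtain ⟨x, hx, hx0⟩ := Submodule.exists_mem_ne_zero_of_ne_bot hK
    exact ⟨x, hx, hx0, by simp⟩
  | insert j T _ ih =>
    obtain ⟨x, hx, hx0, h⟩ := ih
    by_cases hj : p j x = 0
    · refine ⟨x, hx, hx0, fun i hi => ?_⟩
      rcases Finset.mem_insert.1 hi with rfl | hi
      exacts [.inl hj, h i hi]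
    · refine ⟨p j x, hs j x hx, hj, fun i hi => ?_⟩
      rcases Finset.mem_insert.1 hi with rfl | hi
      · exact .inr (congrArg (fun q : Module.End k M => q x) (hp i))
      · have : p i (p j x) = p j (p i x) :=
          congrArg (fun q : Module.End k M => q x) (hc i j).eq
        rcases h i hi with h | h <;> simp [this, h]

/-- The quadratic relations that hold in the exterior powers. -/
def IsExteriorFamily {R : Type*} [Ring R] (E : ι → ι → R) : Prop :=
  ∀ a b c d, E a b * E c d + E c b * E a d =
    (if b = a then E c d else 0) + (if b = c then E a d else 0)

/-- The quadratic relations enter only through $E_{ii}^2=E_{ii}$. These commuting idempotents have a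
common eigenvector $w$, and $S$ is the set of $i$ with eigenvalue $1$. -/
theorem exists_vacuum [CharZero k] [Fintype ι] [Nontrivial M] (hE : IsGlFamily E)
    (hQ : IsExteriorFamily E) : ∃ (S : Finset ι) (w : M), w ≠ 0 ∧ IsVacuum E S w := by
  have hp : ∀ i, E i i * E i i = E i i := by
    intro i
    have := hQ i i i i
    simp only [if_true, ← two_smul k (_ : Module.End k M)] at this
    exact smul_right_injective _ two_ne_zero this
  have hc : ∀ i j, Commute (E i i) (E j j) := by
    intro i j
    have := hE i i j j
    by_cases h : i = j
    · subst h; exact Commute.refl _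
    · simpa [h] using! this
  obtain ⟨w, -, hw0, hw⟩ := exists_common_eigenvector hp hc (K := ⊤) top_ne_bot
    (fun _ _ _ => Submodule.mem_top) Finset.univ
  have key : ∀ a (y : M), E a a (E a a y) = E a a y := fun a y =>
    congrArg (fun q : Module.End k M => q y) (hp a)
  have two : ∀ y : M, y + y = 0 → y = 0 := fun y h => by
    rw [← two_smul k] at h
    exact (smul_eq_zero.1 h).resolve_left two_ne_zero
  classical
  refine ⟨Finset.univ.filter fun i => E i i w = w, w, hw0, fun a b hab => ?_⟩
  simp only [Finset.mem_filter, Finset.mem_univ, true_and] at hab ⊢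
  by_cases hEq : a = b
  · subst hEq
    split_ifs with h
    · exact h.2
    · exact (hw a (Finset.mem_univ a)).resolve_right fun h' => h ⟨rfl, h'⟩
  rw [if_neg fun h => hEq h.1]
  rcases hab with ha | hb
  · have h1 := hE.apply a a a b w
    rw [ha, if_pos rfl, if_neg hEq, sub_zero] at h1
    have h2 := key a (E a b w)
    rw [h1, map_add, h1] at h2
    exact two _ (add_left_cancel (h2.trans (add_zero _).symm))
  · have hb0 := (hw b (Finset.mem_univ b)).resolve_right hb
    -- When $b\notin S$, the vector $E_{ab}w$ would be an eigenvector of the idempotent $E_{bb}$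
    -- with eigenvalue $-1$.
    have h1 := hE.apply b b a b w
    rw [hb0, if_pos rfl, if_neg (Ne.symm hEq), map_zero, add_zero, zero_sub] at h1
    have h2 := key b (E a b w)
    rw [h1, map_neg, h1, neg_neg] at h2
    exact two _ (by nth_rewrite 1 [h2]; exact neg_add_cancel _)

end GlFamily

/-! ### Exterior powers as $\mathfrak{gl}_n$-modules -/

section ExteriorPower
open exteriorPower

variable {k : Type*} [Field k]

theorem LinearMap.update_id_apply {V κ : Type*} [AddCommGroup V] [Module k V] [DecidableEq κ]
    (X : Module.End k V) (v : κ → V) (j : κ) :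
    (fun i => (Function.update (fun _ => LinearMap.id) j X : κ → Module.End k V) i (v i)) =
      Function.update v j (X (v j)) := by
  funext i
  by_cases h : i = j
  · subst h; simp
  · simp [h]

/-- The multilinear map `v ↦ ∑ⱼ v₁ ∧ ⋯ ∧ X vⱼ ∧ ⋯ ∧ vₘ` is alternating. -/
def exteriorPower.derivationAlternating {V : Type*} [AddCommGroup V] [Module k V] (m : ℕ)
    (X : Module.End k V) : V [⋀^Fin m]→ₗ[k] ⋀[k]^m V where
  __ := ∑ j, (ιMulti k m (M := V)).toMultilinearMap.compLinearMap
    (Function.update (fun _ => LinearMap.id) j X)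
  map_eq_zero_of_eq' v a b hv hab := by
    simp only [MultilinearMap.toFun_eq_coe, _root_.sum_apply,
      MultilinearMap.compLinearMap_apply, LinearMap.update_id_apply, AlternatingMap.coe_multilinearMap]
    -- If $v_a=v_b$, every term with $j\ne a,b$ keeps a repeated factor. The two remaining terms
    -- differ by a transposition and cancel.
    rw [← Finset.sum_subset (Finset.subset_univ {a, b}), Finset.sum_pair hab]
    · have : Function.update v b (X (v b)) = Function.update v a (X (v a)) ∘ Equiv.swap a b := by
        funext i
        simp only [Function.comp_apply, Equiv.swap_apply_def, Function.update_apply]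
        split_ifs <;> simp_all
      rw [this, AlternatingMap.map_swap _ _ hab, add_neg_cancel]
    · intro j _ hj
      simp only [Finset.mem_insert, Finset.mem_singleton, not_or] at hj
      refine AlternatingMap.map_eq_zero_of_eq _ _ (i := a) (j := b) ?_ hab
      rw [Function.update_of_ne (Ne.symm hj.1), Function.update_of_ne (Ne.symm hj.2), hv]

variable {V : Type*} [AddCommGroup V] [Module k V] {m : ℕ}

theorem exteriorPower.derivationAlternating_apply (X : Module.End k V) (v : Fin m → V) :
    derivationAlternating m X v = ∑ j, ιMulti k m (Function.update v j (X (v j))) := by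
  simp only [derivationAlternating, ← AlternatingMap.coe_multilinearMap]
  change (∑ j, (ιMulti k m (M := V)).toMultilinearMap.compLinearMap
    (Function.update (fun _ => LinearMap.id) j X)) v = _
  simp only [_root_.sum_apply, MultilinearMap.compLinearMap_apply, LinearMap.update_id_apply]

/-- The action of an endomorphism of `V` on `⋀ᵐ V` as a derivation. -/
noncomputable def exteriorPower.derivation (m : ℕ) :
    Module.End k V →ₗ[k] Module.End k (⋀[k]^m V) where
  toFun X := alternatingMapLinearEquiv (derivationAlternating m X)
  map_add' X Y := by
    refine linearMap_ext (AlternatingMap.ext fun v => ?_)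
    simp [derivationAlternating_apply, AlternatingMap.map_update_add, Finset.sum_add_distrib]
  map_smul' c X := by
    refine linearMap_ext (AlternatingMap.ext fun v => ?_)
    simp [derivationAlternating_apply, AlternatingMap.map_update_smul, Finset.smul_sum]

theorem exteriorPower.derivation_ιMulti (X : Module.End k V) (v : Fin m → V) :
    derivation m X (ιMulti k m v) = ∑ j, ιMulti k m (Function.update v j (X (v j))) := by
  simp [derivation, derivationAlternating_apply]

/-- In the product of the two derivations, the terms where $X$ and $Y$ hit different factors are
symmetric in $X$ and $Y$. They cancel in the commutator, which leaves $XY-YX$ on single factors. -/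
theorem exteriorPower.derivation_commutator (X Y : Module.End k V) :
    derivation m X * derivation m Y - derivation m Y * derivation m X =
      derivation m (X * Y - Y * X) := by
  refine linearMap_ext (AlternatingMap.ext fun v => ?_)
  have key : ∀ X Y : Module.End k V, derivation m X (derivation m Y (ιMulti k m v)) =
      ∑ j, (ιMulti k m (Function.update v j (X (Y (v j)))) + ∑ i ∈ Finset.univ.erase j,
        ιMulti k m (Function.update (Function.update v j (Y (v j))) i (X (v i)))) := by
    intro X Y
    rw [derivation_ιMulti, map_sum]
    refine Finset.sum_congr rfl fun j _ => ?_
    rw [derivation_ιMulti, ← Finset.add_sum_erase _ _ (Finset.mem_univ j)]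
    congr 1
    · simp
    · refine Finset.sum_congr rfl fun i hi => ?_
      rw [Function.update_of_ne (Finset.ne_of_mem_erase hi)]
  have swap : ∑ j, ∑ i ∈ Finset.univ.erase j,
        ιMulti k m (Function.update (Function.update v j (Y (v j))) i (X (v i))) =
      ∑ j, ∑ i ∈ Finset.univ.erase j,
        ιMulti k m (Function.update (Function.update v j (X (v j))) i (Y (v i))) := by
    rw [Finset.sum_comm' (t' := Finset.univ) (s' := fun i => Finset.univ.erase i)]
    · refine Finset.sum_congr rfl fun j _ => Finset.sum_congr rfl fun i hi => ?_
      rw [Function.update_comm (Finset.ne_of_mem_erase hi)]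
    · intro i j
      simp [eq_comm]
  simp only [LinearMap.compAlternatingMap_apply, LinearMap.sub_apply, Module.End.mul_apply, key,
    Finset.sum_add_distrib, swap]
  simp only [derivation_ιMulti, LinearMap.sub_apply, Module.End.mul_apply,
    AlternatingMap.map_update_sub, Finset.sum_sub_distrib]
  abel

variable (k) in
/-- The elementary matrices acting on `⋀ᵐ kⁿ`. -/
noncomputable def exteriorPower.elementary (n m : ℕ) (a b : Fin n) :
    Module.End k (⋀[k]^m (Fin n → k)) :=
  derivation m (Matrix.toLin' (Matrix.single a b 1))

theorem Matrix.isGlFamily_single {n : ℕ} :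
    IsGlFamily fun a b : Fin n => (Matrix.single a b (1 : k) : Matrix (Fin n) (Fin n) k) := by
  intro a b c d
  rcases eq_or_ne b c with rfl | h <;> rcases eq_or_ne a d with rfl | h' <;> simp [*, Ne.symm]

variable {n : ℕ}

theorem exteriorPower.isGlFamily_elementary : IsGlFamily (elementary k n m) := by
  refine .of_sub fun a b c d => ?_
  have h := Matrix.isGlFamily_single (k := k) a b c d
  dsimp only at h
  rw [add_sub_assoc, ← sub_eq_iff_eq_add'] at h
  rw [elementary, elementary, derivation_commutator, Module.End.mul_eq_comp,
    Module.End.mul_eq_comp, ← Matrix.toLin'_mul, ← Matrix.toLin'_mul, ← map_sub, h, map_sub,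
    map_sub]
  congr 1 <;> split_ifs <;> simp [elementary]

/-- The vector `e_{f 1} ∧ ⋯ ∧ e_{f m}`. -/
noncomputable def exteriorPower.wedge (f : Fin m → Fin n) : ⋀[k]^m (Fin n → k) :=
  ιMulti k m fun j => Pi.single (f j) 1

theorem exteriorPower.elementary_wedge (a b : Fin n) (f : Fin m → Fin n) :
    elementary k n m a b (wedge f) =
      ∑ j, if f j = b then wedge (Function.update f j a) else 0 := by
  rw [elementary, wedge, derivation_ιMulti]
  refine Finset.sum_congr rfl fun j _ => ?_
  have h : Matrix.toLin' (Matrix.single a b (1 : k)) (Pi.single (f j) 1) =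
      if f j = b then Pi.single a 1 else 0 := by
    rw [Matrix.toLin'_apply, Matrix.mulVec_single_one]
    ext i
    split_ifs with h
    · simp [Matrix.single_apply, Pi.single_apply, h, eq_comm]
    · simp [Ne.symm h]
  rw [h]
  split_ifs with h
  · rw [wedge]
    congr 1
    funext i
    by_cases hi : i = j
    · subst hi; simp
    · simp [hi]
  · exact AlternatingMap.map_update_zero _ _ _

theorem exteriorPower.elementary_wedge_of_eq {f : Fin m → Fin n} (hf : Function.Injective f)
    (a : Fin n) (j : Fin m) :
    elementary k n m a (f j) (wedge f) = wedge (Function.update f j a) := by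
  rw [elementary_wedge, Finset.sum_eq_single j, if_pos rfl]
  · exact fun i _ hi => if_neg fun h => hi (hf h)
  · simp

theorem exteriorPower.elementary_wedge_of_notMem {f : Fin m → Fin n} (a : Fin n) {b : Fin n}
    (hb : b ∉ Set.range f) : elementary k n m a b (wedge f) = 0 := by
  rw [elementary_wedge]
  exact Finset.sum_eq_zero fun j _ => if_neg fun h => hb ⟨j, h⟩

theorem exteriorPower.wedge_eq_zero {f : Fin m → Fin n} (hf : ¬ Function.Injective f) :
    wedge (k := k) f = 0 := by
  refine AlternatingMap.map_eq_zero_of_not_injective _ _ fun h => hf fun i j hij => h ?_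
  simp [hij]

/-- The operator $E_{ab}$ replaces $e_b$ by $e_a$. It gives zero if $e_b$ is absent, and a repeated
factor if $e_a$ is already present with $a\ne b$. -/
theorem exteriorPower.isVacuum_wedge {f : Fin m → Fin n} (hf : Function.Injective f) :
    IsVacuum (elementary k n m) (Finset.univ.image f) (wedge f) := by
  intro a b hab
  by_cases hb : b ∈ Set.range f
  · obtain ⟨j, rfl⟩ := hb
    have ha : a ∈ Finset.univ.image f := by simpa using hab
    rw [elementary_wedge_of_eq hf]
    split_ifs with h
    · rw [h.1, Function.update_eq_self]
    · refine wedge_eq_zero fun hi => ?_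
      obtain ⟨i, -, rfl⟩ := Finset.mem_image.1 ha
      have hij : i ≠ j := fun e => h ⟨e ▸ rfl, ha⟩
      exact hij (hi (by simp [hij]))
  · rw [elementary_wedge_of_notMem a hb, if_neg]
    rintro ⟨rfl, h⟩
    exact hb (by simpa using h)

/-- Induction on the number of positions where $f$ and $g$ differ. At such a position $i$, if $g(i)$
is already a value of $f$, a transposition moves it into place at the cost of a sign. Otherwise
$E_{g(i),f(i)}$ puts it there. -/
theorem exteriorPower.wedge_mem_of_wedge_mem {K : Submodule k (⋀[k]^m (Fin n → k))}
    (hK : ∀ a b, ∀ x ∈ K, elementary k n m a b x ∈ K) {g : Fin m → Fin n}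
    (hg : Function.Injective g) {f : Fin m → Fin n} (hf : Function.Injective f)
    (hfK : wedge f ∈ K) : wedge g ∈ K := by
  induction hN : (Finset.univ.filter fun i => f i ≠ g i).card using Nat.strong_induction_on
    generalizing f with
  | _ N ih =>
    by_cases hfg : f = g
    · rwa [← hfg]
    obtain ⟨i, hi⟩ := Function.ne_iff.1 hfg
    by_cases hr : g i ∈ Set.range f
    · obtain ⟨l, hl⟩ := hr
      have hil : i ≠ l := fun h => hi (by rw [h, hl, h])
      refine ih _ ?_ (f := f ∘ Equiv.swap i l) (hf.comp (Equiv.injective _)) ?_ rfl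
      · rw [← hN]
        refine Finset.card_lt_card (Finset.ssubset_iff_of_subset ?_ |>.2 ⟨i, ?_, ?_⟩)
        · intro j hj
          simp only [Finset.mem_filter, Finset.mem_univ, true_and, Function.comp_apply] at hj ⊢
          by_cases hji : j = i
          · rw [hji]; exact hi
          by_cases hjl : j = l
          · rw [hjl, hl]; exact fun h => hil (hg h)
          · rwa [Equiv.swap_apply_of_ne_of_ne hji hjl] at hj
        · simpa using hi
        · simp [hl]
      · have : wedge (k := k) (f ∘ Equiv.swap i l) = - wedge f :=
          AlternatingMap.map_swap (ιMulti k m) (fun j => (Pi.single (f j) (1 : k) : Fin n → k)) hil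
        rw [this]
        exact neg_mem hfK
    · refine ih _ ?_ (f := Function.update f i (g i)) ?_ ?_ rfl
      · rw [← hN]
        refine Finset.card_lt_card (Finset.ssubset_iff_of_subset ?_ |>.2 ⟨i, ?_, ?_⟩)
        · intro j hj
          simp only [Finset.mem_filter, Finset.mem_univ, true_and] at hj ⊢
          by_cases hji : j = i
          · rw [hji]; exact hi
          · rwa [Function.update_of_ne hji] at hj
        · simpa using hi
        · simp
      · intro a b hab
        by_cases ha : a = i <;> by_cases hb : b = i
        · rw [ha, hb]
        · subst ha; rw [Function.update_self, Function.update_of_ne hb] at hab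
          exact (hr ⟨b, hab.symm⟩).elim
        · subst hb; rw [Function.update_self, Function.update_of_ne ha] at hab
          exact (hr ⟨a, hab⟩).elim
        · rw [Function.update_of_ne ha, Function.update_of_ne hb] at hab
          exact hf hab
      · rw [← elementary_wedge_of_eq hf]
        exact hK _ _ _ hfK

open Set in
theorem exteriorPower.basis_eq_wedge (s : powersetCard (Fin n) m) :
    (Pi.basisFun k (Fin n)).exteriorPower m s = wedge (powersetCard.ofFinEmbEquiv.symm s) := by
  rw [coe_basis, ιMulti_family, wedge]
  congr 1
  funext j
  simp [Pi.basisFun_apply]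

open Set in
-- The $E_{ii}$ are diagonal in the standard basis, and their eigenvalues on a basis vector
-- determine its index set. A common eigenvector in $K$ is therefore a multiple of one basis vector,
-- from which all the others are reached.
theorem exteriorPower.isIrreducibleFamily_elementary :
    IsIrreducibleFamily k (elementary k n m) := by
  classical
  intro K hK
  refine or_iff_not_imp_left.2 fun hK0 => ?_
  set B := (Pi.basisFun k (Fin n)).exteriorPower m with hB
  have inj : ∀ s : powersetCard (Fin n) m, Function.Injective (powersetCard.ofFinEmbEquiv.symm s) :=
    fun s => (powersetCard.ofFinEmbEquiv.symm s).injective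
  have hdiag : ∀ i s, elementary k n m i i (B s) = if i ∈ s then B s else 0 := by
    intro i s
    rw [hB, basis_eq_wedge]
    split_ifs with h
    · obtain ⟨j, rfl⟩ := (powersetCard.mem_range_ofFinEmbEquiv_symm_iff_mem s i).2 h
      rw [elementary_wedge_of_eq (inj s), Function.update_eq_self]
    · refine elementary_wedge_of_notMem _ fun h' => h ?_
      exact (powersetCard.mem_range_ofFinEmbEquiv_symm_iff_mem s i).1 h'
  have hcoord : ∀ i x s, B.repr (elementary k n m i i x) s = if i ∈ s then B.repr x s else 0 := by
    intro i x s
    have : (B.coord s) ∘ₗ elementary k n m i i = if i ∈ s then B.coord s else 0 := by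
      refine B.ext fun t => ?_
      rw [LinearMap.comp_apply, hdiag]
      by_cases hst : t = s
      · subst hst; split_ifs <;> simp
      · split_ifs <;> simp [hst]
    have h2 := LinearMap.congr_fun this x
    split_ifs at h2 ⊢ <;> exact h2
  obtain ⟨x, hx, hx0, he⟩ := exists_common_eigenvector (p := fun i => elementary k n m i i)
    (fun i => B.ext fun s => by
      simp only [Module.End.mul_apply, hdiag]; split_ifs with h <;> simp [hdiag, h])
    (fun i j => B.ext fun s => by
      simp only [Module.End.mul_apply, hdiag]; split_ifs with h h' h' <;> simp [hdiag, h, h'])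
    hK0 (fun i => hK i i) Finset.univ
  obtain ⟨s, hs⟩ : ∃ s, B.repr x s ≠ 0 := by
    by_contra! h
    exact hx0 (B.ext_elem fun s => by simp [h s])
  -- Every index set in the support of $x$ equals $\{i : E_{ii}x=x\}$, so the support is a single
  -- index set.
  have huniq : ∀ t, B.repr x t ≠ 0 → t = s := by
    have hmem : ∀ t, B.repr x t ≠ 0 → ∀ i, i ∈ t ↔ elementary k n m i i x = x := by
      intro t ht i
      have h := hcoord i x t
      constructor
      · intro hi
        refine (he i (Finset.mem_univ i)).resolve_left fun h0 => ht ?_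
        rw [h0, if_pos hi] at h
        simpa using h.symm
      · intro hi
        by_contra hit
        rw [hi, if_neg hit] at h
        exact ht h
    intro t ht
    refine SetLike.ext fun i => ?_
    rw [hmem t ht, hmem s hs]
  have hxs : x = B.repr x s • B s := by
    refine B.ext_elem fun t => ?_
    by_cases hts : t = s
    · subst hts; simp
    · have : B.repr x t = 0 := by_contra fun h => hts (huniq t h)
      simp [this, Ne.symm hts]
  have hsK : B s ∈ K := by
    rw [hxs] at hx
    exact (K.smul_mem_iff hs).1 hx
  rw [eq_top_iff, ← B.span_eq, Submodule.span_le]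
  rintro _ ⟨t, rfl⟩
  rw [hB, basis_eq_wedge] at hsK ⊢
  exact wedge_mem_of_wedge_mem hK (inj t) (inj s) hsK

end ExteriorPower

/-! ### Recognition of exterior powers by quadratic relations -/

/-- An irreducible finite-dimensional `gl n`-module that satisfies the quadratic relations of the
exterior powers is an exterior power. -/
theorem exists_isExteriorPower {k : Type*} [Field k] [CharZero k] {n : ℕ} (W : Type*)
    [AddCommGroup W] [Module k W] [LieRingModule (Matrix (Fin n) (Fin n) k) W]
    [LieModule k (Matrix (Fin n) (Fin n) k) W] [Nontrivial W]
    (hW : IsIrreducibleFamily k fun a b : Fin n =>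
      LieModule.toEnd k (Matrix (Fin n) (Fin n) k) W (Matrix.single a b 1))
    (hE : IsGlFamily fun a b : Fin n =>
      LieModule.toEnd k (Matrix (Fin n) (Fin n) k) W (Matrix.single a b 1))
    (hQ : IsExteriorFamily fun a b : Fin n =>
      LieModule.toEnd k (Matrix (Fin n) (Fin n) k) W (Matrix.single a b 1)) :
    ∃ m ≤ n, IsExteriorPower k n m W := by
  obtain ⟨S, w, hw0, hw⟩ := exists_vacuum hE hQ
  refine ⟨S.card, by simpa using S.card_le_univ, ?_⟩
  -- The degree of the exterior power is $|S|$. Enumerating $S$ gives a wedge that is a vacuum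
  -- vector for the same $S$ as $w$.
  let f := S.orderEmbOfFin rfl
  have hS : Finset.univ.image f = S := by simp [f]
  have hl := exteriorPower.isVacuum_wedge (k := k) f.injective
  rw [hS] at hl
  have hl0 : exteriorPower.wedge (k := k) f ≠ 0 := by
    have := (Module.Basis.exteriorPower S.card (Pi.basisFun k (Fin n))).ne_zero ⟨S, rfl⟩
    rwa [exteriorPower.basis_eq_wedge] at this
  obtain ⟨e, he⟩ := exists_equiv_of_vacuum hE exteriorPower.isGlFamily_elementary hW
    exteriorPower.isIrreducibleFamily_elementary hw hl hw0 hl0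
  refine ⟨e, fun X v => ?_⟩
  have key : ∀ x, ⁅X, e x⁆ = e (exteriorPower.derivation S.card (Matrix.toLin' X) x) := by
    induction X using Matrix.induction_on' with
    | h_zero => simp
    | h_add X Y hX hY => intro x; simp [hX, hY]
    | h_std_basis a b c =>
      intro x
      have : (Matrix.single a b c : Matrix (Fin n) (Fin n) k) = c • Matrix.single a b 1 := by
        rw [Matrix.smul_single, smul_eq_mul, mul_one]
      rw [this, smul_lie, map_smul, map_smul, LinearMap.smul_apply, map_smul]
      exact congrArg (c • ·) (he a b x).symm
  rw [key, exteriorPower.derivation_ιMulti, map_sum]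
  rfl

/-! ### Functions and vector fields acting on $P\otimes W$ -/

section DiffOp
variable {k A : Type u} [CommRing k] [CommRing A] [Algebra k A]

theorem DiffOp.ofDer_mul_ofFun (η : Derivation k A A) (f : A) :
    ofDer k A η * ofFun k A f = ofFun k A f * ofDer k A η + ofFun k A (η f) := by
  refine Subtype.ext (LinearMap.ext fun a => ?_)
  change η (f * a) = f * η a + η f * a
  rw [Derivation.leibniz, smul_eq_mul, smul_eq_mul, mul_comm a]

theorem DiffOp.ofDer_smul (f : A) (η : Derivation k A A) :
    ofDer k A (f • η) = ofFun k A f * ofDer k A η := rfl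

end DiffOp

section TensorOperators
open SmashLie

section
variable {k A : Type u} [CommRing k] [CommRing A] [Algebra k A]
variable (P : Type*) [AddCommGroup P] [Module k P] [Module (DiffOp k A) P]
  [IsScalarTower k (DiffOp k A) P] (W : Type*) [AddCommGroup W] [Module k W]

theorem tensorFun_tmul (f : A) (p : P) (w : W) :
    tensorFun P W f (p ⊗ₜ[k] w) = (DiffOp.ofFun k A f • p) ⊗ₜ[k] w := rfl

theorem tensorFun_mul (f g : A) :
    tensorFun (k := k) P W (f * g) = tensorFun P W f * tensorFun P W g := by
  refine TensorProduct.ext' fun p w => ?_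
  simp [tensorFun_tmul, mul_smul]

theorem tensorFun_one : tensorFun (k := k) (A := A) P W 1 = 1 := by
  refine TensorProduct.ext' fun p w => ?_
  simp [tensorFun_tmul]

theorem tensorFun_zero : tensorFun (k := k) (A := A) P W 0 = 0 := by
  refine TensorProduct.ext' fun p w => ?_
  simp [tensorFun_tmul]

theorem lTensor_mul_tensorFun (q : Module.End k W) (f : A) :
    q.lTensor P * tensorFun P W f = tensorFun P W f * q.lTensor P := by
  refine TensorProduct.ext' fun p w => ?_
  simp [tensorFun_tmul]

end

/-- The noncommutative computation behind `tensorFun_mul_exteriorDefect`: `La`, `Lc`, `Lh` stand for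
multiplication by $x_a$, $x_c$, $h$, while `r` and `D` stand for the actions of $h\,\partial_b$ and
$\partial_d$. After functions are moved to the left, everything containing `D` cancels and so does
everything containing `r`. The terms left are those created by $\delta$ or quadratic in the
matrices. -/
theorem quadratic_identity {R : Type*} [Ring R] {La Lc Lh r D Eab Ecb Ead Ecd δa δc : R}
    (hac : La * Lc = Lc * La) (hah : La * Lh = Lh * La) (hch : Lc * Lh = Lh * Lc)
    (hδ : Lc * δa = δa * Lc) (ha : r * La = La * r + δa) (hc : r * Lc = Lc * r + δc)
    (he1 : Eab * Lc = Lc * Eab) (he2 : Ecb * La = La * Ecb) :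
    δa * Ecd + δc * Ead - Lh * Eab * Ecd - Lh * Ecb * Ead =
      (La * (Lc * r + Lh * Ecb) + Lc * Lh * Eab) * D - (La * r + Lh * Eab) * (Lc * D + Ecd) -
      (Lc * r + Lh * Ecb) * (La * D + Ead) + r * (La * (Lc * D + Ecd) + Lc * Ead) := by
  have assoc : ∀ {a b c d : R}, a * b = c * d → ∀ z, a * (b * z) = c * (d * z) :=
    fun h z => by rw [← mul_assoc, h, mul_assoc]
  have assoc' : ∀ {a b c d e : R}, a * b = c * d + e → ∀ z, a * (b * z) = c * (d * z) + e * z :=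
    fun h z => by rw [← mul_assoc, h, add_mul, mul_assoc]
  simp only [mul_add, add_mul, mul_assoc, assoc' ha, assoc' hc, assoc he1, assoc he2,
    assoc hac.symm, assoc hah.symm, assoc hch.symm, assoc hδ.symm]
  abel

namespace UniformizingParameters
variable {k A : Type u} [CommRing k] [CommRing A] [Algebra k A] {n : ℕ}
variable (x : UniformizingParameters k A n) (P : Type*) [AddCommGroup P] [Module k P]
  [Module (DiffOp k A) P] [IsScalarTower k (DiffOp k A) P]
  (W : Type*) [AddCommGroup W] [Module k W] [LieRingModule (Matrix (Fin n) (Fin n) k) W]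
  [LieModule k (Matrix (Fin n) (Fin n) k) W]

variable (k n) in
/-- The elementary matrices as operators on `W`. -/
noncomputable abbrev _root_.elementaryEnd (a b : Fin n) : Module.End k W :=
  LieModule.toEnd k (Matrix (Fin n) (Fin n) k) W (Matrix.single a b 1)

/-- The action of a vector field on `P ⊗ W`. -/
noncomputable def tensorDer (η : Derivation k A A) : Module.End k (P ⊗[k] W) :=
  x.tensorSmash P W (SmashLie.mk 1 η)

theorem tensorDer_tmul (η : Derivation k A A) (p : P) (w : W) :
    x.tensorDer P W η (p ⊗ₜ w) = (DiffOp.ofDer k A η • p) ⊗ₜ[k] w +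
      ∑ i, ∑ j, (DiffOp.ofFun k A (x.pderiv j (η (x.x i))) • p) ⊗ₜ[k] elementaryEnd k n W j i w := by
  rw [tensorDer, tensorSmash_mk_tmul]
  simp only [one_smul, one_mul]
  rfl

theorem tensorSmash_mk (f : A) (η : Derivation k A A) :
    x.tensorSmash P W (SmashLie.mk f η) = tensorFun P W f * x.tensorDer P W η := by
  refine TensorProduct.ext' fun p w => ?_
  rw [Module.End.mul_apply, tensorDer_tmul, tensorSmash_mk_tmul]
  simp only [map_add, map_sum, tensorFun_tmul, DiffOp.ofDer_smul, map_mul, mul_smul]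
  rfl

theorem tensorDer_mul_tensorFun (η : Derivation k A A) (f : A) :
    x.tensorDer P W η * tensorFun P W f =
      tensorFun P W f * x.tensorDer P W η + tensorFun P W (η f) := by
  refine TensorProduct.ext' fun p w => ?_
  simp only [Module.End.mul_apply, LinearMap.add_apply, tensorDer_tmul, tensorFun_tmul, map_add,
    map_sum, ← mul_smul, DiffOp.ofDer_mul_ofFun, add_smul, TensorProduct.add_tmul]
  simp only [← map_mul, mul_comm f]
  abel

/-- The differential operator part commutes with $1\otimes q$, so only the matrix part contributes
to the commutator. -/
theorem tensorDer_mul_lTensor (η : Derivation k A A) (q : Module.End k W) :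
    x.tensorDer P W η * q.lTensor P = q.lTensor P * x.tensorDer P W η +
      ∑ i, ∑ j, tensorFun P W (x.pderiv j (η (x.x i))) *
        (elementaryEnd k n W j i * q - q * elementaryEnd k n W j i).lTensor P := by
  refine TensorProduct.ext' fun p w => ?_
  simp only [Module.End.mul_apply, LinearMap.add_apply, LinearMap.sum_apply, tensorDer_tmul,
    LinearMap.lTensor_tmul, map_add, map_sum, LinearMap.sub_apply, TensorProduct.tmul_sub, map_sub,
    tensorFun_tmul, Finset.sum_sub_distrib]
  abel

/-- The action on $P\otimes W$ is not linear over functions, and the defect is first order in $f$.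
This defect is how products of vector fields detect the matrices on $W$. -/
theorem tensorDer_smul (f : A) (η : Derivation k A A) :
    x.tensorDer P W (f • η) = tensorFun P W f * x.tensorDer P W η +
      ∑ i, ∑ j, tensorFun P W (x.pderiv j f * η (x.x i)) * (elementaryEnd k n W j i).lTensor P := by
  refine TensorProduct.ext' fun p w => ?_
  simp only [Module.End.mul_apply, LinearMap.add_apply, LinearMap.sum_apply, tensorDer_tmul,
    LinearMap.lTensor_tmul, tensorFun_tmul, map_add, map_sum, Derivation.smul_apply, smul_eq_mul,
    Derivation.leibniz, DiffOp.ofDer_smul, mul_smul, add_smul, TensorProduct.add_tmul,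
    Finset.sum_add_distrib, map_mul]
  simp only [← mul_smul, ← map_mul, mul_comm, add_assoc]

/-- Since $\partial_j x_a=\delta_{ja}$, multiplying by a coordinate isolates a single elementary
matrix. -/
theorem tensorDer_x_smul (a : Fin n) (g : A) (i : Fin n) :
    x.tensorDer P W ((x.x a * g) • x.pderiv i) =
      tensorFun P W (x.x a) * x.tensorDer P W (g • x.pderiv i) +
        tensorFun P W g * (elementaryEnd k n W a i).lTensor P := by
  rw [mul_smul, tensorDer_smul]
  congr 1
  rw [Finset.sum_eq_single i, Finset.sum_eq_single a]
  · simp [x.pderiv_x]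
  · intro b _ hb
    rw [x.pderiv_x, if_neg hb, zero_mul, tensorFun_zero, zero_mul]
  · simp
  · intro b _ hb
    refine Finset.sum_eq_zero fun j _ => ?_
    rw [Derivation.smul_apply, x.pderiv_x i b, if_neg (Ne.symm hb), smul_zero, mul_zero,
      tensorFun_zero, zero_mul]
  · simp

variable (k n) in
/-- The quadratic operators that vanish on the exterior powers. -/
noncomputable def _root_.exteriorDefect (a b c d : Fin n) : Module.End k W :=
  (if b = a then elementaryEnd k n W c d else 0) + (if b = c then elementaryEnd k n W a d else 0) -
    elementaryEnd k n W a b * elementaryEnd k n W c d -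
    elementaryEnd k n W c b * elementaryEnd k n W a d

/-- A combination of products of two vector fields that acts on `P ⊗ W` as an operator of the form
`h ⊗ q`. -/
theorem tensorFun_mul_exteriorDefect (h : A) (a b c d : Fin n) :
    tensorFun P W h * (exteriorDefect k n W a b c d).lTensor P =
      x.tensorDer P W ((x.x a * (x.x c * h)) • x.pderiv b) * x.tensorDer P W (x.pderiv d) -
      x.tensorDer P W ((x.x a * h) • x.pderiv b) * x.tensorDer P W (x.x c • x.pderiv d) -
      x.tensorDer P W ((x.x c * h) • x.pderiv b) * x.tensorDer P W (x.x a • x.pderiv d) +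
      x.tensorDer P W (h • x.pderiv b) * x.tensorDer P W ((x.x a * x.x c) • x.pderiv d) := by
  have h1 : ∀ c, x.tensorDer P W (x.x c • x.pderiv d) =
      tensorFun P W (x.x c) * x.tensorDer P W (x.pderiv d) +
        (elementaryEnd k n W c d).lTensor P := by
    intro c
    have := x.tensorDer_x_smul P W c 1 d
    rwa [mul_one, one_smul, tensorFun_one, one_mul] at this
  have hδ : ∀ c, x.tensorDer P W (h • x.pderiv b) * tensorFun P W (x.x c) =
      tensorFun P W (x.x c) * x.tensorDer P W (h • x.pderiv b) +
        if b = c then tensorFun P W h else 0 := by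
    intro c
    rw [tensorDer_mul_tensorFun, Derivation.smul_apply, x.pderiv_x]
    split_ifs
    · rw [smul_eq_mul, mul_one]
    · rw [smul_zero, tensorFun_zero]
  have hL : ∀ f g : A, tensorFun (k := k) P W f * tensorFun P W g = tensorFun P W g * tensorFun P W f :=
    fun f g => by rw [← tensorFun_mul, mul_comm, tensorFun_mul]
  -- All coordinate factors are extracted, which expresses the right-hand side through the actions
  -- of $h\,\partial_b$ and $\partial_d$, functions and matrices.
  simp only [tensorDer_x_smul, h1, tensorFun_mul]
  have hac := hL (x.x a) (x.x c)
  have hah := hL (x.x a) h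
  have hch := hL (x.x c) h
  have hEa := fun a c b => lTensor_mul_tensorFun P W (elementaryEnd k n W a b) (x.x c)
  have e : (exteriorDefect k n W a b c d).lTensor P =
      (if b = a then (elementaryEnd k n W c d).lTensor P else 0) +
      (if b = c then (elementaryEnd k n W a d).lTensor P else 0) -
      (elementaryEnd k n W a b).lTensor P * (elementaryEnd k n W c d).lTensor P -
      (elementaryEnd k n W c b).lTensor P * (elementaryEnd k n W a d).lTensor P := by
    rw [exteriorDefect, LinearMap.lTensor_sub, LinearMap.lTensor_sub, LinearMap.lTensor_add,
      LinearMap.lTensor_mul, LinearMap.lTensor_mul]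
    congr 3 <;> split_ifs <;> simp
  rw [e]
  have ha := hδ a
  have hc := hδ c
  have he1 := hEa a c b
  have he2 := hEa c a b
  have e' : tensorFun P W h * ((if b = a then (elementaryEnd k n W c d).lTensor P else 0) +
      (if b = c then (elementaryEnd k n W a d).lTensor P else 0)) =
      (if b = a then tensorFun P W h else 0) * (elementaryEnd k n W c d).lTensor P +
      (if b = c then tensorFun P W h else 0) * (elementaryEnd k n W a d).lTensor P := by
    split_ifs <;> simp [mul_add]
  rw [mul_sub, mul_sub, e', ← mul_assoc, ← mul_assoc]
  refine quadratic_identity hac hah hch ?_ ha hc he1 he2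
  split_ifs
  · exact hch
  · rw [mul_zero, zero_mul]

end UniformizingParameters
end TensorOperators

/-! ### Passage from $\widehat{\mathcal{AV}}$-simplicity to irreducibility over vector fields -/

section Irreducibility

theorem isGlFamily_elementaryEnd (k : Type*) [Field k] (n : ℕ) (W : Type*) [AddCommGroup W]
    [Module k W] [LieRingModule (Matrix (Fin n) (Fin n) k) W]
    [LieModule k (Matrix (Fin n) (Fin n) k) W] : IsGlFamily (elementaryEnd k n W) := by
  refine .of_sub fun a b c d => ?_
  have h := Matrix.isGlFamily_single (k := k) a b c d
  dsimp only at h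
  rw [add_sub_assoc, ← sub_eq_iff_eq_add'] at h
  have := (LieModule.toEnd k (Matrix (Fin n) (Fin n) k) W).map_lie (Matrix.single a b 1)
    (Matrix.single c d 1)
  rw [Ring.lie_def, Ring.lie_def, h] at this
  rw [elementaryEnd, elementaryEnd, ← this, map_sub]
  congr 1 <;> split_ifs <;> simp

theorem isIrreducibleFamily_elementaryEnd {k : Type*} [Field k] {n : ℕ} {W : Type*}
    [AddCommGroup W] [Module k W] [LieRingModule (Matrix (Fin n) (Fin n) k) W]
    [LieModule k (Matrix (Fin n) (Fin n) k) W]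
    (hW : LieModule.IsIrreducible k (Matrix (Fin n) (Fin n) k) W) :
    IsIrreducibleFamily k (elementaryEnd k n W) := by
  intro K hK
  let K' : LieSubmodule k (Matrix (Fin n) (Fin n) k) W :=
    { K with
      lie_mem := fun {X w} hw => by
        change ⁅X, w⁆ ∈ K
        induction X using Matrix.induction_on' with
        | h_zero => simp
        | h_add X Y hX hY => rw [add_lie]; exact add_mem hX hY
        | h_std_basis a b c =>
          have : (Matrix.single a b c : Matrix (Fin n) (Fin n) k) = c • Matrix.single a b 1 := by
            rw [Matrix.smul_single, smul_eq_mul, mul_one]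
          rw [this, smul_lie]
          exact K.smul_mem c (hK a b w hw) }
  rcases hW.eq_bot_or_eq_top K' with h | h
  · exact .inl (congrArg LieSubmodule.toSubmodule h)
  · exact .inr (congrArg LieSubmodule.toSubmodule h)

/-- If a family of operators on `W` has no common kernel, then neither do the induced operators on
`P ⊗ W`. -/
theorem eq_zero_of_lTensor_eq_zero {k P W : Type*} [Field k] [AddCommGroup P] [Module k P]
    [AddCommGroup W] [Module k W] {s : Set (Module.End k W)}
    (hs : ∀ w, (∀ q ∈ s, q w = 0) → w = 0) {t : P ⊗[k] W}
    (ht : ∀ q ∈ s, q.lTensor P t = 0) : t = 0 := by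
  classical
  -- Expanding in a basis of $P$, the operator $1\otimes q$ applies $q$ to each coefficient in $W$.
  -- Every coefficient thus lies in the common kernel.
  let b := Module.Basis.ofVectorSpace k P
  let e := TensorProduct.equivFinsuppOfBasisLeft (N := W) b
  refine e.injective (Finsupp.ext fun i => ?_)
  rw [map_zero, Finsupp.zero_apply]
  refine hs _ fun q hq => ?_
  have h : ∀ t, e (q.lTensor P t) i = q (e t i) := by
    intro t
    induction t using TensorProduct.induction_on with
    | zero => simp
    | add t t' h h' => simp [h, h']
    | tmul p w => simp [e]
  rw [← h, ht q hq, map_zero, Finsupp.zero_apply]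

namespace UniformizingParameters
variable {k A : Type u} [Field k] [CommRing A] [Algebra k A] {n : ℕ}
variable (x : UniformizingParameters k A n) {P : Type*} [AddCommGroup P] [Module k P]
  [Module (DiffOp k A) P] [IsScalarTower k (DiffOp k A) P]
  {W : Type*} [AddCommGroup W] [Module k W] [LieRingModule (Matrix (Fin n) (Fin n) k) W]
  [LieModule k (Matrix (Fin n) (Fin n) k) W]

variable (A) in
/-- The operators `q` on `W` such that all `f ⊗ q`, `f ∈ A`, preserve `N`. -/
def _root_.stabilizingEnd (N : Submodule k (P ⊗[k] W)) : Set (Module.End k W) :=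
  {q | ∀ f : A, ∀ t ∈ N, tensorFun P W f (q.lTensor P t) ∈ N}

variable {x} {N : Submodule k (P ⊗[k] W)}

/-- In `tensorFun_mul_exteriorDefect` the function $h$ is free, and the right-hand side involves
only vector fields, which preserve $N$. -/
theorem exteriorDefect_mem_stabilizingEnd (hN : ∀ η, ∀ t ∈ N, x.tensorDer P W η t ∈ N)
    (a b c d : Fin n) : exteriorDefect k n W a b c d ∈ stabilizingEnd A N := by
  intro f t ht
  rw [← Module.End.mul_apply, x.tensorFun_mul_exteriorDefect]
  exact add_mem (sub_mem (sub_mem (hN _ _ (hN _ _ ht)) (hN _ _ (hN _ _ ht)))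
    (hN _ _ (hN _ _ ht))) (hN _ _ (hN _ _ ht))

/-- This is what makes both the span `N'` stable under vector fields and the common kernel `W₀`
stable under $\mathfrak{gl}_n$ in `eq_bot_or_eq_top_of_tensorDer`. -/
theorem commutator_mem_stabilizingEnd (hN : ∀ η, ∀ t ∈ N, x.tensorDer P W η t ∈ N)
    {q : Module.End k W} (hq : q ∈ stabilizingEnd A N) (a b : Fin n) :
    elementaryEnd k n W a b * q - q * elementaryEnd k n W a b ∈ stabilizingEnd A N := by
  intro f t ht
  -- For $\eta=x_a\partial_b$ one has $\partial_j(\eta x_i)=\delta_{ib}\delta_{ja}$, so commuting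
  -- $\eta$ with $1\otimes q$ yields exactly $1\otimes[E_{ab},q]$.
  set η := x.x a • x.pderiv b with hη
  have h1 := x.tensorDer_mul_lTensor P W η q
  have h2 : ∑ i, ∑ j, tensorFun P W (x.pderiv j (η (x.x i))) *
        (elementaryEnd k n W j i * q - q * elementaryEnd k n W j i).lTensor P =
      (elementaryEnd k n W a b * q - q * elementaryEnd k n W a b).lTensor P := by
    rw [Finset.sum_eq_single b, Finset.sum_eq_single a]
    · simp [hη, x.pderiv_x, tensorFun_one]
    · intro j _ hj
      rw [hη, Derivation.smul_apply, x.pderiv_x b b, if_pos rfl, smul_eq_mul, mul_one, x.pderiv_x,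
        if_neg hj, tensorFun_zero, zero_mul]
    · simp
    · intro i _ hi
      refine Finset.sum_eq_zero fun j _ => ?_
      rw [hη, Derivation.smul_apply, x.pderiv_x b i, if_neg (Ne.symm hi), smul_zero, map_zero,
        tensorFun_zero, zero_mul]
    · simp
  rw [h2] at h1
  -- Each term on the right preserves $N$. The middle one does so because $q$ is stabilizing for the
  -- function $\eta(f)$ as well as for $f$.
  have h3 : tensorFun P W f *
      (elementaryEnd k n W a b * q - q * elementaryEnd k n W a b).lTensor P =
      x.tensorDer P W η * (tensorFun P W f * q.lTensor P) -
        tensorFun P W (η f) * q.lTensor P -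
        tensorFun P W f * q.lTensor P * x.tensorDer P W η := by
    rw [← mul_assoc, x.tensorDer_mul_tensorFun, add_mul, mul_assoc _ _ (q.lTensor P), h1, mul_add,
      mul_assoc]
    abel
  rw [← Module.End.mul_apply, h3]
  exact sub_mem (sub_mem (hN _ _ (hq f t ht)) (hq _ t ht)) (hq f _ (hN _ _ ht))

/-- If `P ⊗ W` has no proper nonzero subspaces stable under functions and vector fields, and `W` is
irreducible and not an exterior power, then it has no proper nonzero subspaces stable under vector
fields. -/
theorem eq_bot_or_eq_top_of_tensorDer [CharZero k] [Nontrivial W]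
    (hW : IsIrreducibleFamily k (elementaryEnd k n W))
    (hWΛ : ∀ i ≤ n, ¬ IsExteriorPower k n i W)
    (hs : ∀ K : Submodule k (P ⊗[k] W), (∀ f : A, ∀ t ∈ K, tensorFun P W f t ∈ K) →
      (∀ η, ∀ t ∈ K, x.tensorDer P W η t ∈ K) → K = ⊥ ∨ K = ⊤)
    (hN : ∀ η, ∀ t ∈ N, x.tensorDer P W η t ∈ N) : N = ⊥ ∨ N = ⊤ := by
  -- Unlike $N$, the span of these vectors is visibly stable under functions, so the hypothesis `hs`
  -- can be applied to it.
  let gens : Set (P ⊗[k] W) :=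
    {v | ∃ q ∈ stabilizingEnd A N, ∃ f : A, ∃ t ∈ N, tensorFun P W f (q.lTensor P t) = v}
  let N' : Submodule k (P ⊗[k] W) := Submodule.span k gens
  have hle : N' ≤ N := Submodule.span_le.2 <| by
    rintro _ ⟨q, hq, f, t, ht, rfl⟩
    exact hq f t ht
  have stable : ∀ T : Module.End k (P ⊗[k] W), (∀ v ∈ gens, T v ∈ N') → ∀ v ∈ N', T v ∈ N' :=
    fun T hT => Submodule.span_le (p := N'.comap T) |>.2 hT
  have hmem : ∀ q ∈ stabilizingEnd A N, ∀ (f : A), ∀ t ∈ N,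
      tensorFun P W f (q.lTensor P t) ∈ N' :=
    fun q hq f t ht => Submodule.subset_span ⟨q, hq, f, t, ht, rfl⟩
  have hFun : ∀ f : A, ∀ t ∈ N', tensorFun P W f t ∈ N' := by
    intro f
    refine stable _ ?_
    rintro _ ⟨q, hq, g, t, ht, rfl⟩
    rw [← Module.End.mul_apply, ← tensorFun_mul]
    exact hmem q hq _ t ht
  have hDer : ∀ η, ∀ t ∈ N', x.tensorDer P W η t ∈ N' := by
    intro η
    refine stable _ ?_
    rintro _ ⟨q, hq, g, t, ht, rfl⟩
    have h : x.tensorDer P W η * (tensorFun P W g * q.lTensor P) =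
        tensorFun P W g * q.lTensor P * x.tensorDer P W η +
          tensorFun P W g * (∑ i, ∑ j, tensorFun P W (x.pderiv j (η (x.x i))) *
            (elementaryEnd k n W j i * q - q * elementaryEnd k n W j i).lTensor P) +
          tensorFun P W (η g) * q.lTensor P := by
      rw [← mul_assoc, x.tensorDer_mul_tensorFun, add_mul, mul_assoc, x.tensorDer_mul_lTensor,
        mul_add, mul_assoc]
    rw [← Module.End.mul_apply, ← Module.End.mul_apply, mul_assoc, h]
    refine add_mem (add_mem (hmem q hq g _ (hN η t ht)) (hFun g _ ?_)) (hmem q hq _ t ht)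
    simp only [LinearMap.sum_apply]
    exact sum_mem fun i _ => sum_mem fun j _ =>
      hmem _ (commutator_mem_stabilizingEnd hN hq j i) _ t ht
  rcases hs N' hFun hDer with h | h
  swap
  · exact .inr (top_le_iff.1 (h ▸ hle))
  -- The span is zero; taking $f=1$ shows that every stabilizing operator kills $N$.
  have hann : ∀ q ∈ stabilizingEnd A N, ∀ t ∈ N, q.lTensor P t = 0 := by
    intro q hq t ht
    have := hmem q hq 1 t ht
    rwa [h, tensorFun_one, Submodule.mem_bot] at this
  let W₀ : Submodule k W := ⨅ q ∈ stabilizingEnd A N, LinearMap.ker q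
  have hW₀ : ∀ w, w ∈ W₀ ↔ ∀ q ∈ stabilizingEnd A N, q w = 0 := fun w => by
    simp [W₀, Submodule.mem_iInf]
  -- For $w\in W_0$, both $q$ and $[E_{ab},q]$ kill $w$, hence $qE_{ab}w=E_{ab}qw-[E_{ab},q]w=0$.
  have hstable : ∀ a b, ∀ w ∈ W₀, elementaryEnd k n W a b w ∈ W₀ := by
    intro a b w hw
    rw [hW₀] at hw ⊢
    intro q hq
    have := hw _ (commutator_mem_stabilizingEnd hN hq a b)
    rw [LinearMap.sub_apply, Module.End.mul_apply, Module.End.mul_apply, hw q hq, map_zero,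
      zero_sub, neg_eq_zero] at this
    exact this
  rcases hW W₀ hstable with h0 | h0
  · refine .inl ((Submodule.eq_bot_iff N).2 fun t ht => ?_)
    refine eq_zero_of_lTensor_eq_zero (s := stabilizingEnd A N) (fun w hw => ?_)
      fun q hq => hann q hq t ht
    have := (hW₀ w).2 hw
    rwa [h0, Submodule.mem_bot] at this
  -- Here every stabilizing operator is zero on $W$, in particular the quadratic ones, which would
  -- make $W$ an exterior power.
  · have hdef : ∀ a b c d, exteriorDefect k n W a b c d = 0 := by
      intro a b c d
      refine LinearMap.ext fun w => ?_
      exact (hW₀ w).1 (h0 ▸ Submodule.mem_top) _ (exteriorDefect_mem_stabilizingEnd hN a b c d)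
    have hQ : IsExteriorFamily (elementaryEnd k n W) := by
      intro a b c d
      have := hdef a b c d
      rw [exteriorDefect, sub_sub, sub_eq_zero] at this
      exact this.symm
    obtain ⟨m, hm, he⟩ := exists_isExteriorPower W hW (isGlFamily_elementaryEnd k n W) hQ
    exact (hWΛ m hm he).elim

/-- A subspace of `P ⊗ W` stable under functions and vector fields is stable under jets. -/
theorem tensorJet_mem (hFun : ∀ f : A, ∀ t ∈ N, tensorFun P W f t ∈ N)
    (hDer : ∀ η, ∀ t ∈ N, x.tensorDer P W η t ∈ N) (s : JetLie k A) {t : P ⊗[k] W} (ht : t ∈ N) :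
    x.tensorJet P W s t ∈ N := by
  -- Index $1$ means modulo $\Delta^2$, and the jet action factors through this quotient. A jet
  -- therefore acts as a representative in $A\# V$, that is, through products of functions and
  -- vector fields.
  obtain ⟨y, hy, -⟩ := JetLie.exists_rep s (le_refl 1)
  have : x.tensorJet P W s = x.tensorSmash P W y :=
    congrArg (Submodule.liftQ (SmashLie.deltaSub k A 2) (x.tensorSmash P W)
      (fun _ hy => x.tensorSmash_deltaSub P W hy)) hy.symm
  rw [this]
  clear this hy
  induction y using SmashLie.induction with
  | zero => simp
  | add y z hy hz => rw [map_add]; exact add_mem hy hz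
  | mk f η =>
    rw [tensorSmash_mk]
    exact hFun f _ (hDer η t ht)

end UniformizingParameters

/-- A subspace stable under functions and jets is stable under `ÂV`. -/
theorem AVhat.smul_mem_of_generators {k A : Type u} [CommRing k] [CommRing A] [Algebra k A]
    {M : Type*} [AddCommGroup M] [Module k M] [Module (AVhat k A) M] [IsScalarTower k (AVhat k A) M]
    {K : Submodule k M} (hFun : ∀ f, ∀ m ∈ K, AVhat.ofFun k A f • m ∈ K)
    (hJet : ∀ s, ∀ m ∈ K, AVhat.ofJet k A s • m ∈ K) (a : AVhat k A) {m : M} (hm : m ∈ K) :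
    a • m ∈ K := by
  obtain ⟨z, rfl⟩ : ∃ z, AVhat.quot k A z = a := RingQuot.mkAlgHom_surjective k (AVhatRel k A) a
  induction z using FreeAlgebra.induction generalizing m with
  | grade0 c =>
    rw [AlgHom.commutes, algebraMap_smul]
    exact K.smul_mem c hm
  | grade1 y =>
    rcases y with f | s
    · exact hFun f m hm
    · exact hJet s m hm
  | mul a b ha hb => rw [map_mul, mul_smul]; exact ha (hb hm)
  | add a b ha hb => rw [map_add, add_smul]; exact add_mem (ha hm) (hb hm)

end Irreducibility

theorem mainTheorem5 {k : Type u} [Field k] [IsAlgClosed k] [CharZero k] [Uncountable k] {n : ℕ}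
    (X : SmoothVariety k n)
    (W : Type v) [AddCommGroup W] [Module k W] [LieRingModule (Matrix (Fin n) (Fin n) k) W]
    [LieModule k (Matrix (Fin n) (Fin n) k) W] [FiniteDimensional k W]
    (hW : LieModule.IsIrreducible k (Matrix (Fin n) (Fin n) k) W)
    (hWΛ : ∀ i ≤ n, ¬ IsExteriorPower k n i W)
    (M : AVhatModule X) (hM : M.IsSimple) (hol : M.IsHolonomic) (hMW : M.IsOfType W)
    (U : EtaleChart X) :
    Subsingleton (M.Sec U) ∨ LieModule.IsIrreducible k U.Vec (M.Sec U) := by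
  rcases hM.2.2 U with h | hsimple
  · exact .inl h
  refine .inr ?_
  obtain ⟨x, P, _, _, _, _, e, heFun, heJet⟩ := hMW U
  have : Nontrivial W := LieModule.nontrivial_of_isIrreducible k (Matrix (Fin n) (Fin n) k) W
  have : Nontrivial (M.Sec U) := IsSimpleModule.nontrivial U.AVhatSec (M.Sec U)
  have heDer : ∀ (η : U.Vec) t, e (x.tensorDer P W η t) = ⁅η, e t⁆ :=
    fun η t => heJet (JetLie.of k U.Fun (SmashLie.mk 1 η)) t
  -- Functions and jets generate `AVhat`, and jets act through functions and vector fields.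
  -- Transport along `e` turns simplicity of `M.Sec U` into a statement about `P ⊗ W`.
  have hs : ∀ K : Submodule k (P ⊗[k] W), (∀ f : U.Fun, ∀ t ∈ K, tensorFun P W f t ∈ K) →
      (∀ η, ∀ t ∈ K, x.tensorDer P W η t ∈ K) → K = ⊥ ∨ K = ⊤ := by
    intro K hFun hDer
    let K' : Submodule U.AVhatSec (M.Sec U) :=
      { K.map e.toLinearMap with
        smul_mem' := fun a m hm => by
          refine AVhat.smul_mem_of_generators (K := K.map e.toLinearMap) ?_ ?_ a hm
          · rintro f _ ⟨t, ht, rfl⟩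
            exact ⟨_, hFun f t ht, heFun f t⟩
          · rintro s _ ⟨t, ht, rfl⟩
            exact ⟨_, UniformizingParameters.tensorJet_mem hFun hDer s ht, heJet s t⟩ }
    have hK' : ∀ t, t ∈ K ↔ e t ∈ K' := fun t =>
      ⟨fun ht => ⟨t, ht, rfl⟩, fun ⟨t', ht', h⟩ => e.injective h ▸ ht'⟩
    rcases eq_bot_or_eq_top K' with h | h
    · refine .inl ((Submodule.eq_bot_iff K).2 fun t ht => ?_)
      rw [hK', h, Submodule.mem_bot] at ht
      exact e.injective (ht.trans (map_zero e).symm)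
    · refine .inr ((Submodule.eq_top_iff').2 fun t => ?_)
      rw [hK', h]
      exact Submodule.mem_top
  refine LieModule.IsIrreducible.mk fun N hN => ?_
  have hN' : ∀ η, ∀ t ∈ N.toSubmodule.comap e.toLinearMap,
      x.tensorDer P W η t ∈ N.toSubmodule.comap e.toLinearMap := by
    intro η t ht
    change e (x.tensorDer P W η t) ∈ N
    rw [heDer]
    exact N.lie_mem ht
  rcases UniformizingParameters.eq_bot_or_eq_top_of_tensorDer
    (isIrreducibleFamily_elementaryEnd hW) hWΛ hs hN' with h | h
  · refine (hN ((LieSubmodule.eq_bot_iff N).2 fun m hm => ?_)).elim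
    have : e.symm m ∈ N.toSubmodule.comap e.toLinearMap := by
      change e (e.symm m) ∈ N
      rwa [e.apply_symm_apply]
    rw [h, Submodule.mem_bot] at this
    exact (LinearEquiv.map_eq_zero_iff e.symm).1 this
  · refine eq_top_iff.2 fun m _ => ?_
    have : e.symm m ∈ N.toSubmodule.comap e.toLinearMap := h ▸ Submodule.mem_top
    rw [← e.apply_symm_apply m]
    exact this
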